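/- Let $n\ge 5$ be an integer and let $\mathcal D^{2,2}(\mathbb R^n)$ be the completion of the space $C_c^\infty(\mathbb R^n)$ of real-valued smooth compactly supported functions with respect to the norm $\left(\int_{\mathbb R^n}|\Delta\varphi|^2\,dx\right)^{1/2}$, realised through the Sobolev embedding as a space of functions: $u\in\mathcal D^{2,2}(\mathbb R^n)$ if and only if $u\in L^{2n/(n-4)}(\mathbb R^n)$ and there are $\varphi_k\in C_c^\infty(\mathbb R^n)$ with $\varphi_k\to u$ in $L^{2n/(n-4)}(\mathbb R^n)$ and $(\Delta\varphi_k)_k$ a Cauchy sequence in $L^2(\mathbb R^n)$. Then every $u\in\mathcal D^{2,2}(\mathbb R^n)$ has a (locally integrable) weak gradient $\nabla u$ and weak Laplacian $\Delta u$, the integrals below are finite, and $$\int_{\mathbb R^n}|\Delta u|^2\,dx\ \ge\ \frac{n^2}{4}\int_{\mathbb R^n}|x|^{-2}|\nabla u|^2\,dx\qquad\text{for every }u\in\mathcal D^{2,2}(\mathbb R^n).$$ The constant $n^2/4$ is the best one: it is the largest real number $c$ such that $\int_{\mathbb R^n}|\Delta u|^2\,dx\ge c\int_{\mathbb R^n}|x|^{-2}|\nabla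 u|^2\,dx$ for all $u\in\mathcal D^{2,2}(\mathbb R^n)$. -/

import Mathlib

open MeasureTheory Filter Topology
open scoped ContDiff Laplacian

/-- The space of real-valued smooth, compactly supported functions on `ℝⁿ`. -/
def IsTestFunction {n : ℕ} (φ : EuclideanSpace ℝ (Fin n) → ℝ) : Prop :=
  ContDiff ℝ ∞ φ ∧ HasCompactSupport φ

/-- `G` is the weak (distributional) gradient of `u`:
`∫ u ∂ᵥφ = - ∫ ⟨G, v⟩ φ` for all directions `v` and all test functions `φ`. -/
def IsWeakGradient {n : ℕ} (u : EuclideanSpace ℝ (Fin n) → ℝ)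
    (G : EuclideanSpace ℝ (Fin n) → EuclideanSpace ℝ (Fin n)) : Prop :=
  LocallyIntegrable u volume ∧ LocallyIntegrable G volume ∧
    ∀ φ : EuclideanSpace ℝ (Fin n) → ℝ, IsTestFunction φ →
      ∀ v : EuclideanSpace ℝ (Fin n),
        ∫ x, u x * fderiv ℝ φ x v = - ∫ x, inner ℝ (G x) v * φ x

/-- `f` is the weak (distributional) Laplacian of `u`:
`∫ u Δφ = ∫ f φ` for all test functions `φ`. -/
def IsWeakLaplacian {n : ℕ} (u f : EuclideanSpace ℝ (Fin n) → ℝ) : Prop :=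
  LocallyIntegrable u volume ∧ LocallyIntegrable f volume ∧
    ∀ φ : EuclideanSpace ℝ (Fin n) → ℝ, IsTestFunction φ →
      ∫ x, u x * (Δ φ) x = ∫ x, f x * φ x

/-- The homogeneous Sobolev space `D^{2,2}(ℝⁿ)`, for `n ≥ 5`: the completion of the smooth
compactly supported functions with respect to the norm `‖Δφ‖_{L²}`, realised as a space of functions
in `L^{2n/(n-4)}(ℝⁿ)`.  A Cauchy sequence of that norm converges in `L^{2n/(n-4)}` by
the Sobolev inequality, and its limit there represents its class in the completion. -/
def MemD22 {n : ℕ} (u : EuclideanSpace ℝ (Fin n) → ℝ) : Prop :=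
  MemLp u (ENNReal.ofReal (2 * (n : ℝ) / ((n : ℝ) - 4))) volume ∧
    ∃ φ : ℕ → EuclideanSpace ℝ (Fin n) → ℝ,
      (∀ k, IsTestFunction (φ k)) ∧
      Tendsto (fun p : ℕ × ℕ => eLpNorm (Δ (φ p.1 - φ p.2)) 2 volume) atTop (𝓝 0) ∧
      Tendsto (fun k => eLpNorm (φ k - u) (ENNReal.ofReal (2 * (n : ℝ) / ((n : ℝ) - 4))) volume)
        atTop (𝓝 0)

/-! For a test function `φ` the inequality comes from a pointwise identity that is then integrated.
Let p be the gradient, S the Hessian, T = tr S, q = Sx, α = x·p, s = x·Sx and P = |p|². Five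
expressions integrate to zero: T² - |S|², and the divergences of Px/|x|², α²x/|x|⁴, αp/|x|² and α(Tx
- q)/|x|². Subtracting a suitable combination of them from T² - (n²/4)P/|x|² leaves |x|⁻⁴ times a
sum of nonnegative terms (`hardyRellich_algebraic`): the square of s + (n-2)α/2, the part of q +
(n-2)p/2 normal to x, the deficit in (tr M)² ≤ (n-1)|M|² for the compression M of S to the
complement of x, and (n²/4 - n - 1)(|x|²P - α²). All of them vanish for |x|^(-(n-4)/2), the virtual
extremal. The assumption n ≥ 5 makes the last coefficient positive and |x|⁻⁴ locally integrable.

For general u, the inequality applied to differences of an approximating sequence makes |x|⁻¹∇φₖ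
Cauchy in L² whenever Δφₖ is. Convergence in L^(2n/(n-4)) identifies the two limits with weak
derivatives of u (`MemD22.exists_weak_derivatives`), and these are unique almost everywhere.

The constant is sharp because slowly cut-off copies of the virtual extremal are test functions: in
the variable t = log|x| both sides become one-dimensional integrals, and slowing the cut-off down
gives n²/4 in the limit (`hardyRellich_constant_le`). -/

/-- The `i`-th partial derivative. -/
noncomputable def partialDeriv {n : ℕ} (i : Fin n) (f : EuclideanSpace ℝ (Fin n) → ℝ) :
    EuclideanSpace ℝ (Fin n) → ℝ :=
  fun x => fderiv ℝ f x (EuclideanSpace.single i 1)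

/-! ### Coordinate calculus and integration by parts against powers of the norm. -/

section Calculus

variable {n : ℕ} {f g : EuclideanSpace ℝ (Fin n) → ℝ}

lemma contDiff_partialDeriv (hf : ContDiff ℝ ∞ f) (i : Fin n) :
    ContDiff ℝ ∞ (partialDeriv i f) :=
  (hf.fderiv_right (m := ∞) (by simp)).clm_apply contDiff_const

lemma contDiff_coord (i : Fin n) :
    ContDiff ℝ ∞ (fun x : EuclideanSpace ℝ (Fin n) => x i) :=
  (EuclideanSpace.proj (𝕜 := ℝ) i).contDiff

lemma partialDeriv_mul (hf : ContDiff ℝ ∞ f) (hg : ContDiff ℝ ∞ g) (i : Fin n)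
    (x : EuclideanSpace ℝ (Fin n)) :
    partialDeriv i (fun y => f y * g y) x =
      f x * partialDeriv i g x + g x * partialDeriv i f x := by
  unfold partialDeriv
  rw [fderiv_fun_mul ((hf.differentiable (by simp)) x) ((hg.differentiable (by simp)) x)]
  simp

lemma partialDeriv_sub (hf : ContDiff ℝ ∞ f) (hg : ContDiff ℝ ∞ g) (i : Fin n)
    (x : EuclideanSpace ℝ (Fin n)) :
    partialDeriv i (fun y => f y - g y) x = partialDeriv i f x - partialDeriv i g x := by
  unfold partialDeriv
  rw [fderiv_fun_sub ((hf.differentiable (by simp)) x) ((hg.differentiable (by simp)) x)]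
  simp

lemma partialDeriv_sum {ι : Type*} (s : Finset ι) {F : ι → EuclideanSpace ℝ (Fin n) → ℝ}
    (hF : ∀ j, ContDiff ℝ ∞ (F j)) (i : Fin n) (x : EuclideanSpace ℝ (Fin n)) :
    partialDeriv i (fun y => ∑ j ∈ s, F j y) x = ∑ j ∈ s, partialDeriv i (F j) x := by
  unfold partialDeriv
  rw [fderiv_fun_sum (fun j _ => ((hF j).differentiable (by simp)) x)]
  simp

lemma partialDeriv_coord (i j : Fin n) (x : EuclideanSpace ℝ (Fin n)) :
    partialDeriv i (fun y => y j) x = if j = i then 1 else 0 := by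
  unfold partialDeriv
  have : (fun y : EuclideanSpace ℝ (Fin n) => y j) = EuclideanSpace.proj (𝕜 := ℝ) j := rfl
  rw [this, ContinuousLinearMap.fderiv]
  simp

lemma partialDeriv_partialDeriv (hf : ContDiff ℝ ∞ f) (i j : Fin n)
    (x : EuclideanSpace ℝ (Fin n)) :
    partialDeriv i (partialDeriv j f) x =
      fderiv ℝ (fderiv ℝ f) x (EuclideanSpace.single i 1) (EuclideanSpace.single j 1) := by
  have h : DifferentiableAt ℝ (fderiv ℝ f) x :=
    (hf.fderiv_right (m := ∞) (by simp)).differentiable (by simp) x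
  unfold partialDeriv
  rw [fderiv_clm_apply h (differentiableAt_const _)]
  simp

lemma partialDeriv_comm (hf : ContDiff ℝ ∞ f) (i j : Fin n) :
    partialDeriv i (partialDeriv j f) = partialDeriv j (partialDeriv i f) := by
  ext x
  rw [partialDeriv_partialDeriv hf, partialDeriv_partialDeriv hf]
  exact ((contDiff_infty.1 hf 2).contDiffAt.isSymmSndFDerivAt (by simp)).eq _ _

lemma laplacian_eq_sum_partialDeriv (hf : ContDiff ℝ ∞ f) (x : EuclideanSpace ℝ (Fin n)) :
    (Δ f) x = ∑ i, partialDeriv i (partialDeriv i f) x := by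
  rw [InnerProductSpace.laplacian_eq_iteratedFDeriv_orthonormalBasis f
    (EuclideanSpace.basisFun (Fin n) ℝ)]
  simp [iteratedFDeriv_two_apply, partialDeriv_partialDeriv hf]

namespace IsTestFunction

lemma continuous (hf : IsTestFunction f) : Continuous f := hf.1.continuous

lemma mul_contDiff (hf : IsTestFunction f) (hg : ContDiff ℝ ∞ g) :
    IsTestFunction (fun x => f x * g x) :=
  ⟨hf.1.mul hg, hf.2.mul_right⟩

lemma contDiff_mul (hf : ContDiff ℝ ∞ f) (hg : IsTestFunction g) :
    IsTestFunction (fun x => f x * g x) :=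
  ⟨hf.mul hg.1, hg.2.mul_left⟩

lemma add (hf : IsTestFunction f) (hg : IsTestFunction g) :
    IsTestFunction (fun x => f x + g x) :=
  ⟨hf.1.add hg.1, hf.2.add hg.2⟩

lemma sub (hf : IsTestFunction f) (hg : IsTestFunction g) :
    IsTestFunction (fun x => f x - g x) :=
  ⟨hf.1.sub hg.1, hf.2.sub hg.2⟩

lemma sum {ι : Type*} (s : Finset ι) {F : ι → EuclideanSpace ℝ (Fin n) → ℝ}
    (hF : ∀ j, IsTestFunction (F j)) : IsTestFunction (fun x => ∑ j ∈ s, F j x) := by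
  classical
  induction s using Finset.induction_on with
  | empty => exact ⟨by simpa using contDiff_const, by simpa using! (HasCompactSupport.zero : HasCompactSupport (0 : EuclideanSpace ℝ (Fin n) → ℝ))⟩
  | insert a s ha ih =>
    simp only [Finset.sum_insert ha]
    exact (hF a).add ih

lemma partialDeriv (hf : IsTestFunction f) (i : Fin n) : IsTestFunction (partialDeriv i f) :=
  ⟨contDiff_partialDeriv hf.1 i, hf.2.fderiv_apply (𝕜 := ℝ) _⟩

lemma integrable (hf : IsTestFunction f) : Integrable f volume :=
  hf.continuous.integrable_of_hasCompactSupport hf.2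

end IsTestFunction

/-- The strongest weight integrated against an arbitrary test function is k = 4, which is admissible
because n ≥ 5. -/
lemma locallyIntegrable_inv_norm_pow {k : ℕ} (hk : k < n) :
    LocallyIntegrable (fun x : EuclideanSpace ℝ (Fin n) => (‖x‖ ^ k)⁻¹) volume := by
  refine locallyIntegrable_of_norm_le_rpow (C := 1) (α := k) (by simp; omega)
    (by simpa using hk) (ae_of_all _ fun x => ?_) (by fun_prop)
  rw [one_mul, Real.rpow_neg (norm_nonneg _), Real.rpow_natCast]
  simp

lemma integrable_mul_inv_norm_pow {k : ℕ} (hk : k < n) (hf : Continuous f)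
    (hfc : HasCompactSupport f) : Integrable (fun x => f x * (‖x‖ ^ k)⁻¹) volume :=
  (locallyIntegrable_inv_norm_pow hk).integrable_smul_left_of_hasCompactSupport hf hfc

/-- Integration by parts against `‖x‖ ^ (-2m)`. -/
lemma integral_partialDeriv_div_norm_pow (m : ℕ) (hg : IsTestFunction g) (i : Fin n)
    (h₁ : Integrable (fun x => partialDeriv i g x / (‖x‖ ^ 2) ^ m) volume)
    (h₂ : Integrable (fun x => x i * g x / (‖x‖ ^ 2) ^ (m + 1)) volume) :
    ∫ x, partialDeriv i g x / (‖x‖ ^ 2) ^ m = 2 * m * ∫ x, x i * g x / (‖x‖ ^ 2) ^ (m + 1) := by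
  have hw : ∀ ε : ℝ, 0 < ε → ∀ x : EuclideanSpace ℝ (Fin n), 0 < ‖x‖ ^ 2 + ε := fun ε hε x => by
    positivity
  -- Shifting ‖x‖² by ε > 0 removes the singularity, so ordinary integration by parts applies; ε → 0
  -- is taken at the end.
  have key : ∀ ε : ℝ, 0 < ε → ∫ x, partialDeriv i g x / (‖x‖ ^ 2 + ε) ^ m =
      ∫ x, 2 * m * (x i * g x / (‖x‖ ^ 2 + ε) ^ (m + 1)) := by
    intro ε hε
    have hd : ∀ x : EuclideanSpace ℝ (Fin n), HasFDerivAt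
        (fun y : EuclideanSpace ℝ (Fin n) => ((‖y‖ ^ 2 + ε) ^ m)⁻¹)
        ((-(2 * m / (‖x‖ ^ 2 + ε) ^ (m + 1))) • innerSL ℝ x) x := by
      intro x
      have h0 : HasFDerivAt (fun y : EuclideanSpace ℝ (Fin n) => ‖y‖ ^ 2 + ε)
          (2 • innerSL ℝ x) x := (hasStrictFDerivAt_norm_sq x).hasFDerivAt.add_const ε
      have h1 : HasDerivAt (fun t : ℝ => (t ^ m)⁻¹) (-(m / (‖x‖ ^ 2 + ε) ^ (m + 1)))
          (‖x‖ ^ 2 + ε) := by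
        have := (hasDerivAt_pow m (‖x‖ ^ 2 + ε)).inv (pow_ne_zero m (hw ε hε x).ne')
        refine this.congr_deriv ?_
        have := (hw ε hε x).ne'
        rcases m with _ | m
        · simp
        · simp only [Nat.add_sub_cancel]
          field_simp
          ring
      refine (h1.comp_hasFDerivAt x h0).congr_fderiv ?_
      ext v
      simp
      ring
    have hc : Continuous (fun y : EuclideanSpace ℝ (Fin n) => ((‖y‖ ^ 2 + ε) ^ m)⁻¹) :=
      continuous_iff_continuousAt.2 fun x => (hd x).continuousAt
    have hc' : Continuous (fun y : EuclideanSpace ℝ (Fin n) => ((‖y‖ ^ 2 + ε) ^ (m + 1))⁻¹) :=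
      Continuous.inv₀ (by fun_prop) fun x => pow_ne_zero _ (hw ε hε x).ne'
    have hfd : ∀ x, fderiv ℝ (fun y : EuclideanSpace ℝ (Fin n) => ((‖y‖ ^ 2 + ε) ^ m)⁻¹) x
        (EuclideanSpace.single i 1) = -(2 * m * x i * ((‖x‖ ^ 2 + ε) ^ (m + 1))⁻¹) := by
      intro x
      rw [(hd x).fderiv]
      simp [EuclideanSpace.inner_single_right]
      ring
    have := integral_mul_fderiv_eq_neg_fderiv_mul_of_integrable (μ := volume)
      (f := fun y : EuclideanSpace ℝ (Fin n) => ((‖y‖ ^ 2 + ε) ^ m)⁻¹) (g := g)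
      (v := EuclideanSpace.single i 1) ?_ ?_ ?_
      (fun x _ => (hd x).differentiableAt) (fun x _ => hg.1.differentiable (by simp) x)
    · calc _ = ∫ x, ((‖x‖ ^ 2 + ε) ^ m)⁻¹ * fderiv ℝ g x (EuclideanSpace.single i 1) := by
            simp only [div_eq_inv_mul, partialDeriv]
        _ = _ := by
          rw [this, ← integral_neg]
          congr 1 with x
          rw [hfd]
          field_simp
    · simp only [hfd]
      exact Continuous.integrable_of_hasCompactSupport (by have := hg.continuous; fun_prop)
        hg.2.mul_left
    · exact Continuous.integrable_of_hasCompactSupport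
        (hc.mul (hg.partialDeriv i).continuous) (hg.partialDeriv i).2.mul_left
    · exact Continuous.integrable_of_hasCompactSupport
        (hc.mul hg.continuous) hg.2.mul_left
  have hne : ∀ᵐ x : EuclideanSpace ℝ (Fin n), x ≠ 0 := by
    have : Nonempty (Fin n) := ⟨i⟩
    exact compl_mem_ae_iff.2 (measure_singleton _)
  -- The shift only enlarges the denominator, so the limiting integrand itself is the dominating
  -- function.
  have lim : ∀ (k : ℕ) (h : EuclideanSpace ℝ (Fin n) → ℝ), Continuous h →
      Integrable (fun x => h x / (‖x‖ ^ 2) ^ k) volume →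
      Tendsto (fun ε : ℝ => ∫ x, h x / (‖x‖ ^ 2 + ε) ^ k) (𝓝[>] 0)
        (𝓝 (∫ x, h x / (‖x‖ ^ 2) ^ k)) := by
    intro k h hh hi
    refine tendsto_integral_filter_of_dominated_convergence _ ?_ ?_ hi.norm ?_
    · filter_upwards [self_mem_nhdsWithin] with ε hε
      exact (hh.div (by fun_prop) fun x => pow_ne_zero _ (hw ε hε x).ne').aestronglyMeasurable
    · filter_upwards [self_mem_nhdsWithin] with ε (hε : 0 < ε)
      filter_upwards [hne] with x hx
      have : 0 < ‖x‖ := norm_pos_iff.2 hx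
      rw [norm_div, norm_div]
      refine div_le_div_of_nonneg_left (norm_nonneg _) (norm_pos_iff.2 (by positivity)) ?_
      simp only [norm_pow, Real.norm_eq_abs]
      rw [abs_of_pos (hw ε hε x), abs_of_nonneg (norm_nonneg x)]
      gcongr
      linarith
    · filter_upwards [hne] with x hx
      have : 0 < ‖x‖ := norm_pos_iff.2 hx
      have : ContinuousAt (fun ε : ℝ => h x / (‖x‖ ^ 2 + ε) ^ k) 0 :=
        ContinuousAt.div (by fun_prop) (by fun_prop) (by rw [add_zero]; positivity)
      simpa using this.tendsto.mono_left nhdsWithin_le_nhds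
  have l₁ := lim m _ (hg.partialDeriv i).continuous h₁
  have l₂ := (lim (m + 1) (fun x => x i * g x) ((contDiff_coord i).continuous.mul hg.continuous) h₂).const_mul
    (2 * m : ℝ)
  refine tendsto_nhds_unique (l₁.congr' ?_) l₂
  filter_upwards [self_mem_nhdsWithin] with ε hε
  rw [key ε hε, integral_const_mul]

end Calculus

/-! ### Pointwise algebra: the sum of squares and the two inequalities feeding it. -/

/-- The algebraic inequality behind the sharp Hardy-Rellich inequality, for the rotation invariants
of a Hessian, a gradient and a position vector. -/
lemma hardyRellich_algebraic {N T A B C P s α R : ℝ} (hN : 5 ≤ N) (hR : 0 < R)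
    (h₂ : 0 ≤ (R * B - s ^ 2) + 2 * ((N - 2) / 2) * (R * C - s * α) +
      ((N - 2) / 2) ^ 2 * (R * P - α ^ 2))
    (h₃ : (R * T - s) ^ 2 ≤ (N - 1) * (R ^ 2 * A - 2 * R * B + s ^ 2))
    (h₄ : α ^ 2 ≤ R * P) :
    (N - 1) / (N - 2) * (T ^ 2 - A)
      - 2 / (N - 2) * ((N * α * T - C + s * T - B) / R - 2 * α * (T * R - s) / R ^ 2)
      - (N - 1 + 1 / (N - 2)) * ((N * P + 2 * C) / R - 2 * P / R)
      + ((N - 2) / 2 + 2 / (N - 2)) * ((N * α ^ 2 + 2 * α * (α + s)) / R ^ 2 - 4 * α ^ 2 / R ^ 2)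
      + 2 * ((P + C + α * T) / R - 2 * α ^ 2 / R ^ 2)
      ≤ T ^ 2 - N ^ 2 / 4 * (P / R) := by
  have hN2 : 0 < N - 2 := by linarith
  -- This is N²/4 - N - 1, equal to 1/4 at N = 5 but to -1 at N = 4.
  have hγ : 0 ≤ N - 1 + N ^ 2 / 4 - 2 * N := by nlinarith
  -- The multipliers of the five divergences are such that the remainder is a combination of the
  -- hypotheses and one square, all zero when φ = |x|^(-(N-4)/2).
  have key : (T ^ 2 - N ^ 2 / 4 * (P / R)) - ((N - 1) / (N - 2) * (T ^ 2 - A)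
      - 2 / (N - 2) * ((N * α * T - C + s * T - B) / R - 2 * α * (T * R - s) / R ^ 2)
      - (N - 1 + 1 / (N - 2)) * ((N * P + 2 * C) / R - 2 * P / R)
      + ((N - 2) / 2 + 2 / (N - 2)) * ((N * α ^ 2 + 2 * α * (α + s)) / R ^ 2 - 4 * α ^ 2 / R ^ 2)
      + 2 * ((P + C + α * T) / R - 2 * α ^ 2 / R ^ 2)) =
      ((s + (N - 2) / 2 * α) ^ 2 + 2 * ((R * B - s ^ 2) + 2 * ((N - 2) / 2) * (R * C - s * α) +
      ((N - 2) / 2) ^ 2 * (R * P - α ^ 2)) + 1 / (N - 2) *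
      ((N - 1) * (R ^ 2 * A - 2 * R * B + s ^ 2) - (R * T - s) ^ 2)
      + (N - 1 + N ^ 2 / 4 - 2 * N) * (R * P - α ^ 2)) / R ^ 2 := by
    have := hN2.ne'
    field_simp
    ring
  have hnn := div_nonneg (add_nonneg (add_nonneg (add_nonneg
    (sq_nonneg (s + (N - 2) / 2 * α)) (mul_nonneg zero_le_two h₂))
    (mul_nonneg (one_div_nonneg.2 hN2.le) (sub_nonneg.2 h₃)))
    (mul_nonneg hγ (sub_nonneg.2 h₄))) (sq_nonneg R)
  rw [← key] at hnn
  linarith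

section FiniteSums

variable {ι : Type*} [Fintype ι]

/-- The trace inequality `(tr M)² ≤ (N-1) |M|²` for the compression `M` of a symmetric matrix to the
orthogonal complement of a vector. -/
lemma trace_sq_le_of_compression [DecidableEq ι] (S : ι → ι → ℝ) (hS : ∀ i j, S i j = S j i)
    (x : ι → ℝ) (hN : 1 < (Fintype.card ι : ℝ)) (q : ι → ℝ) (hq : ∀ i, q i = ∑ j, x j * S i j)
    (R s T : ℝ) (hR : R = ∑ i, x i ^ 2) (hR0 : 0 < R) (hs : s = ∑ i, x i * q i)
    (hT : T = ∑ i, S i i) :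
    (R * T - s) ^ 2 ≤ ((Fintype.card ι : ℝ) - 1) *
      (R ^ 2 * (∑ i, ∑ j, S i j ^ 2) - 2 * R * (∑ i, q i ^ 2) + s ^ 2) := by
  set N : ℝ := (Fintype.card ι : ℝ) with hNdef
  -- Here c is the mean eigenvalue of R times the compression on the (N-1)-dimensional complement of
  -- x. The inequality says that subtracting c times the projection leaves a matrix of nonnegative
  -- squared norm.
  set c : ℝ := (R * T - s) / (N - 1) with hc
  have hN1 : 0 < N - 1 := by linarith
  set A := ∑ i, ∑ j, S i j ^ 2 with hA
  set B := ∑ i, q i ^ 2 with hB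
  have e1 : ∑ i, ∑ j, S i j * (q i * x j) = B := by
    simp only [hB]
    refine Finset.sum_congr rfl fun i _ => ?_
    rw [pow_two]
    nth_rw 3 [hq i]
    rw [Finset.mul_sum]
    exact Finset.sum_congr rfl fun j _ => by ring
  have e1' : ∑ i, ∑ j, S i j * (x i * q j) = B := by
    rw [Finset.sum_comm, ← e1]
    refine Finset.sum_congr rfl fun i _ => Finset.sum_congr rfl fun j _ => ?_
    rw [hS j i]; ring
  have e2 : ∑ i, ∑ j, S i j * (x i * x j) = s := by
    rw [hs]
    refine Finset.sum_congr rfl fun i _ => ?_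
    rw [hq i, Finset.mul_sum]
    exact Finset.sum_congr rfl fun j _ => by ring
  have d : ∀ F : ι → ι → ℝ, ∑ i, ∑ j, F i j * (if i = j then (1 : ℝ) else 0) = ∑ i, F i i :=
    fun F => by simp
  have d1 := d S
  have d2 := d fun i j => x i * q j
  have d3 := d fun i j => x i * x j
  have d4 := d fun i j => (if i = j then (1 : ℝ) else 0)
  rw [← hT] at d1
  rw [← hs] at d2
  simp only [← pow_two (x _)] at d3
  rw [← hR] at d3
  simp only [if_true, Finset.sum_const, Finset.card_univ, nsmul_eq_mul, mul_one] at d4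
  rw [← hNdef] at d4
  have hexp : ∑ i, ∑ j, (R * S i j - (q i * x j + x i * q j) + (s / R) * (x i * x j)
      - c * ((if i = j then (1 : ℝ) else 0) - (x i * x j) / R)) ^ 2 =
      R ^ 2 * A - 2 * R * B + s ^ 2 - 2 * c * (R * T - s) + c ^ 2 * (N - 1) := by
    have hx : ∀ i j, (R * S i j - (q i * x j + x i * q j) + (s / R) * (x i * x j)
        - c * ((if i = j then (1 : ℝ) else 0) - (x i * x j) / R)) ^ 2 =
        R ^ 2 * S i j ^ 2 + q i ^ 2 * x j ^ 2 + x i ^ 2 * q j ^ 2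
        + ((s + c) / R) ^ 2 * (x i ^ 2 * x j ^ 2)
        - 2 * R * (S i j * (q i * x j)) - 2 * R * (S i j * (x i * q j))
        + 2 * (s + c) * (S i j * (x i * x j))
        + 2 * ((x i * q i) * (x j * q j)) - 2 * ((s + c) / R) * ((x i * q i) * (x j ^ 2))
        - 2 * ((s + c) / R) * ((x i ^ 2) * (x j * q j))
        - 2 * c * R * (S i j * (if i = j then (1 : ℝ) else 0))
        + 2 * c * ((x i * q j) * (if i = j then (1 : ℝ) else 0))
        + 2 * c * ((x i * q j) * (if i = j then (1 : ℝ) else 0))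
        - 2 * c * ((s + c) / R) * ((x i * x j) * (if i = j then (1 : ℝ) else 0))
        + c ^ 2 * ((if i = j then (1 : ℝ) else 0) * (if i = j then (1 : ℝ) else 0)) := by
      intro i j
      split_ifs with h
      · subst h; field_simp; ring
      · field_simp; ring
    simp only [hx, Finset.sum_add_distrib, Finset.sum_sub_distrib, ← Finset.mul_sum,
      ← Finset.sum_mul]
    rw [e1, e1', e2, d1, d2, d3, d4, ← hR, ← hs, ← hB, ← hA]
    field_simp
    ring
  have hnn : 0 ≤ R ^ 2 * A - 2 * R * B + s ^ 2 - 2 * c * (R * T - s) + c ^ 2 * (N - 1) :=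
    hexp ▸ Finset.sum_nonneg fun i _ => Finset.sum_nonneg fun j _ => sq_nonneg _
  have hcm : c * (N - 1) = R * T - s := by rw [hc]; field_simp
  have : (R * T - s) ^ 2 = (N - 1) * (c * (R * T - s)) := by rw [← hcm]; ring
  rw [this]
  refine mul_le_mul_of_nonneg_left ?_ hN1.le
  have : c ^ 2 * (N - 1) = c * (R * T - s) := by rw [← hcm]; ring
  linarith

/-- Up to a factor R, the expression is the squared norm of R(q + kp) minus its component (s + kα)x
along x. -/
lemma sum_rejection_sq_nonneg (x p q : ι → ℝ) (k R s α B C P : ℝ) (hR : R = ∑ i, x i ^ 2)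
    (hR0 : 0 < R) (hs : s = ∑ i, x i * q i) (hα : α = ∑ i, x i * p i) (hB : B = ∑ i, q i ^ 2)
    (hC : C = ∑ i, p i * q i) (hP : P = ∑ i, p i ^ 2) :
    0 ≤ (R * B - s ^ 2) + 2 * k * (R * C - s * α) + k ^ 2 * (R * P - α ^ 2) := by
  have h : ∑ i, (R * (q i + k * p i) - (s + k * α) * x i) ^ 2 =
      R * ((R * B - s ^ 2) + 2 * k * (R * C - s * α) + k ^ 2 * (R * P - α ^ 2)) := by
    have hx : ∀ i, (R * (q i + k * p i) - (s + k * α) * x i) ^ 2 =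
        R ^ 2 * q i ^ 2 + 2 * R ^ 2 * k * (p i * q i) + R ^ 2 * k ^ 2 * p i ^ 2
        - 2 * R * (s + k * α) * (x i * q i) - 2 * R * (s + k * α) * k * (x i * p i)
        + (s + k * α) ^ 2 * x i ^ 2 := fun i => by ring
    simp only [hx, Finset.sum_add_distrib, Finset.sum_sub_distrib, ← Finset.mul_sum]
    rw [← hR, ← hs, ← hα, ← hB, ← hC, ← hP]
    ring
  have h0 := Finset.sum_nonneg fun i (_ : i ∈ Finset.univ) =>
    sq_nonneg (R * (q i + k * p i) - (s + k * α) * x i)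
  rw [h] at h0
  exact nonneg_of_mul_nonneg_right h0 hR0

end FiniteSums

/-! ### Weighted divergence theorems across the origin. -/

section Divergence

variable {n : ℕ}

lemma IsTestFunction.integrable_div_norm_pow {g : EuclideanSpace ℝ (Fin n) → ℝ}
    (hg : IsTestFunction g) {m : ℕ} (hm : 2 * m < n) :
    Integrable (fun x => g x / (‖x‖ ^ 2) ^ m) volume := by
  simpa only [div_eq_mul_inv, pow_mul] using integrable_mul_inv_norm_pow hm hg.continuous hg.2

lemma IsTestFunction.coord_mul {g : EuclideanSpace ℝ (Fin n) → ℝ} (hg : IsTestFunction g)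
    (i : Fin n) : IsTestFunction (fun x => x i * g x) :=
  .contDiff_mul (contDiff_coord i) hg

/-- The weighted divergence theorem for the weight `‖x‖ ^ (-2)`. -/
lemma integral_divergence_div_norm_sq (hn : 5 ≤ n) {V : Fin n → EuclideanSpace ℝ (Fin n) → ℝ}
    (hV : ∀ i, IsTestFunction (V i)) :
    Integrable (fun x => (∑ i, partialDeriv i (V i) x) / ‖x‖ ^ 2
      - 2 * (∑ i, x i * V i x) / (‖x‖ ^ 2) ^ 2) volume ∧
    ∫ x, ((∑ i, partialDeriv i (V i) x) / ‖x‖ ^ 2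
      - 2 * (∑ i, x i * V i x) / (‖x‖ ^ 2) ^ 2) = 0 := by
  have h₁ : ∀ i, Integrable (fun x => partialDeriv i (V i) x / (‖x‖ ^ 2) ^ 1) volume :=
    fun i => ((hV i).partialDeriv i).integrable_div_norm_pow (by omega)
  have h₂ : ∀ i, Integrable (fun x => x i * V i x / (‖x‖ ^ 2) ^ (1 + 1)) volume :=
    fun i => ((hV i).coord_mul i).integrable_div_norm_pow (by omega)
  have e : ∀ x : EuclideanSpace ℝ (Fin n), (∑ i, partialDeriv i (V i) x) / ‖x‖ ^ 2
      - 2 * (∑ i, x i * V i x) / (‖x‖ ^ 2) ^ 2 = ∑ i, (partialDeriv i (V i) x / (‖x‖ ^ 2) ^ 1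
      - 2 * (x i * V i x / (‖x‖ ^ 2) ^ (1 + 1))) := fun x => by
    simp only [Finset.sum_sub_distrib, ← Finset.mul_sum, ← Finset.sum_div]
    ring
  simp only [e]
  have hi : ∀ i, Integrable (fun x => partialDeriv i (V i) x / (‖x‖ ^ 2) ^ 1
      - 2 * (x i * V i x / (‖x‖ ^ 2) ^ (1 + 1))) volume := fun i => (h₁ i).sub ((h₂ i).const_mul 2)
  refine ⟨integrable_finsetSum _ fun i _ => hi i, ?_⟩
  rw [integral_finsetSum _ fun i _ => hi i]
  refine Finset.sum_eq_zero fun i _ => ?_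
  rw [integral_sub (h₁ i) ((h₂ i).const_mul 2), integral_const_mul,
    integral_partialDeriv_div_norm_pow 1 (hV i) i (h₁ i) (h₂ i)]
  simp

/-- The weighted divergence theorem for the radial field `h x`, with weight `‖x‖ ^ (-4)`. -/
lemma integral_radial_divergence_div_norm_pow_four (hn : 5 ≤ n)
    {h : EuclideanSpace ℝ (Fin n) → ℝ} (hh : IsTestFunction h) :
    Integrable (fun x => (∑ i, partialDeriv i (fun y => y i * h y) x) / (‖x‖ ^ 2) ^ 2
      - 4 * h x / (‖x‖ ^ 2) ^ 2) volume ∧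
    ∫ x, ((∑ i, partialDeriv i (fun y => y i * h y) x) / (‖x‖ ^ 2) ^ 2
      - 4 * h x / (‖x‖ ^ 2) ^ 2) = 0 := by
  have h₀ : Integrable (fun x => h x / (‖x‖ ^ 2) ^ 2) volume :=
    hh.integrable_div_norm_pow (by omega)
  have h₁ : ∀ i, Integrable (fun x => partialDeriv i (fun y => y i * h y) x / (‖x‖ ^ 2) ^ 2)
      volume := fun i => ((hh.coord_mul i).partialDeriv i).integrable_div_norm_pow (by omega)
  -- The weight ‖x‖⁻⁶ need not be locally integrable when n is 5 or 6; the two factors x i reduce it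
  -- to ‖x‖⁻⁴.
  have h₂ : ∀ i, Integrable (fun x => x i * (x i * h x) / (‖x‖ ^ 2) ^ (2 + 1)) volume := by
    intro i
    have hc := hh.continuous
    refine h₀.norm.mono' (Measurable.aestronglyMeasurable (by fun_prop)) (ae_of_all _ fun x => ?_)
    rcases eq_or_ne x 0 with rfl | hx
    · simp
    have hx' : 0 < ‖x‖ := norm_pos_iff.2 hx
    rw [show x i * (x i * h x) / (‖x‖ ^ 2) ^ (2 + 1) =
      (x i ^ 2 / ‖x‖ ^ 2) * (h x / (‖x‖ ^ 2) ^ 2) by field_simp; ring, norm_mul]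
    refine mul_le_of_le_one_left (norm_nonneg _) ?_
    rw [Real.norm_eq_abs, abs_of_nonneg (by positivity), div_le_one (by positivity)]
    exact sq_le_sq.2 (by simpa using PiLp.norm_apply_le x i)
  have e : ∀ᵐ x : EuclideanSpace ℝ (Fin n),
      (∑ i, partialDeriv i (fun y => y i * h y) x) / (‖x‖ ^ 2) ^ 2 - 4 * h x / (‖x‖ ^ 2) ^ 2 =
      ∑ i, (partialDeriv i (fun y => y i * h y) x / (‖x‖ ^ 2) ^ 2
      - 4 * (x i * (x i * h x) / (‖x‖ ^ 2) ^ (2 + 1))) := by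
    have : Nonempty (Fin n) := ⟨⟨0, by omega⟩⟩
    have hne : ∀ᵐ x : EuclideanSpace ℝ (Fin n), x ≠ 0 := compl_mem_ae_iff.2 (measure_singleton _)
    filter_upwards [hne] with x hx
    have hx' : 0 < ‖x‖ := norm_pos_iff.2 hx
    have hs : ∑ i, x i * (x i * h x) = ‖x‖ ^ 2 * h x := by
      rw [EuclideanSpace.real_norm_sq_eq, Finset.sum_mul]
      exact Finset.sum_congr rfl fun i _ => by ring
    simp only [Finset.sum_sub_distrib, ← Finset.mul_sum, ← Finset.sum_div]
    rw [hs]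
    field_simp
    ring
  have hi : ∀ i, Integrable (fun x => partialDeriv i (fun y => y i * h y) x / (‖x‖ ^ 2) ^ 2
      - 4 * (x i * (x i * h x) / (‖x‖ ^ 2) ^ (2 + 1))) volume :=
    fun i => (h₁ i).sub ((h₂ i).const_mul 4)
  refine ⟨(integrable_congr e).2 (integrable_finsetSum _ fun i _ => hi i), ?_⟩
  rw [integral_congr_ae e, integral_finsetSum _ fun i _ => hi i]
  refine Finset.sum_eq_zero fun i _ => ?_
  rw [integral_sub (h₁ i) ((h₂ i).const_mul 4), integral_const_mul,
    integral_partialDeriv_div_norm_pow 2 (hh.coord_mul i) i (h₁ i) (h₂ i)]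
  norm_num

end Divergence

/-! ### The inequality for test functions, from five vanishing integrals. -/

section HardyRellich

variable {n : ℕ} {φ : EuclideanSpace ℝ (Fin n) → ℝ}

lemma integral_mul_partialDeriv {f g : EuclideanSpace ℝ (Fin n) → ℝ} (hf : IsTestFunction f)
    (hg : IsTestFunction g) (i : Fin n) :
    ∫ x, f x * partialDeriv i g x = - ∫ x, partialDeriv i f x * g x :=
  integral_mul_fderiv_eq_neg_fderiv_mul_of_integrable
    ((hf.partialDeriv i).mul_contDiff hg.1).integrable
    (hf.mul_contDiff (hg.partialDeriv i).1).integrable (hf.mul_contDiff hg.1).integrable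
    (fun x _ => hf.1.differentiable (by simp) x) (fun x _ => hg.1.differentiable (by simp) x)

/-- `∫ |Δφ|² = ∫ |D²φ|²`. -/
lemma integral_laplacian_sq_sub_hessian_sq (hφ : IsTestFunction φ) :
    Integrable (fun x => (∑ i, partialDeriv i (partialDeriv i φ) x) ^ 2
      - ∑ i, ∑ j, partialDeriv i (partialDeriv j φ) x ^ 2) volume ∧
    ∫ x, ((∑ i, partialDeriv i (partialDeriv i φ) x) ^ 2
      - ∑ i, ∑ j, partialDeriv i (partialDeriv j φ) x ^ 2) = 0 := by
  have ht : ∀ i j, IsTestFunction (partialDeriv i (partialDeriv j φ)) :=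
    fun i j => (hφ.partialDeriv j).partialDeriv i
  have e : ∀ x, (∑ i, partialDeriv i (partialDeriv i φ) x) ^ 2
      - ∑ i, ∑ j, partialDeriv i (partialDeriv j φ) x ^ 2 = ∑ i, ∑ j,
      (partialDeriv i (partialDeriv i φ) x * partialDeriv j (partialDeriv j φ) x
      - partialDeriv i (partialDeriv j φ) x * partialDeriv i (partialDeriv j φ) x) := fun x => by
    simp only [Finset.sum_sub_distrib, pow_two, Finset.sum_mul_sum]
  have h₁ : ∀ i j k l, Integrable (fun x => partialDeriv i (partialDeriv j φ) x *
      partialDeriv k (partialDeriv l φ) x) volume :=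
    fun i j k l => ((ht i j).mul_contDiff (ht k l).1).integrable
  simp only [e]
  have h₂ : ∀ i j, Integrable (fun x =>
      partialDeriv i (partialDeriv i φ) x * partialDeriv j (partialDeriv j φ) x
      - partialDeriv i (partialDeriv j φ) x * partialDeriv i (partialDeriv j φ) x) volume :=
    fun i j => (h₁ i i j j).sub (h₁ i j i j)
  refine ⟨integrable_finsetSum _ fun i _ => integrable_finsetSum _ fun j _ => h₂ i j, ?_⟩
  rw [integral_finsetSum _ fun i _ => integrable_finsetSum _ fun j _ => h₂ i j]
  refine Finset.sum_eq_zero fun i _ => ?_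
  rw [integral_finsetSum _ fun j _ => h₂ i j]
  refine Finset.sum_eq_zero fun j _ => ?_
  rw [integral_sub (h₁ i i j j) (h₁ i j i j), integral_mul_partialDeriv (ht i i)
    (hφ.partialDeriv j), partialDeriv_comm (hφ.partialDeriv i).1 j i, partialDeriv_comm hφ.1 j i,
    ← neg_neg (∫ x, partialDeriv i (partialDeriv j φ) x * partialDeriv i (partialDeriv j φ) x),
    integral_mul_partialDeriv (ht i j) (hφ.partialDeriv j), partialDeriv_comm hφ.1 i j]
  ring

lemma sum_coord_sq (x : EuclideanSpace ℝ (Fin n)) : ∑ i, x i ^ 2 = ‖x‖ ^ 2 :=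
  (EuclideanSpace.real_norm_sq_eq x).symm

/-- The Hardy-Rellich inequality for test functions, in coordinates. -/
theorem hardyRellich_partialDeriv (hn : 5 ≤ n) (hφ : IsTestFunction φ) :
    (n : ℝ) ^ 2 / 4 * ∫ x, (∑ i, partialDeriv i φ x ^ 2) / ‖x‖ ^ 2 ≤
      ∫ x, (∑ i, partialDeriv i (partialDeriv i φ) x) ^ 2 := by
  classical
  have hN : (5 : ℝ) ≤ n := by exact_mod_cast hn
  set p : Fin n → EuclideanSpace ℝ (Fin n) → ℝ := fun i => partialDeriv i φ with hp
  set S : Fin n → Fin n → EuclideanSpace ℝ (Fin n) → ℝ :=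
    fun i j => partialDeriv i (partialDeriv j φ) with hS
  have hpt : ∀ i, IsTestFunction (p i) := fun i => hφ.partialDeriv i
  have hSt : ∀ i j, IsTestFunction (S i j) := fun i j => (hpt j).partialDeriv i
  have hdp : ∀ i j, partialDeriv i (p j) = S i j := fun i j => rfl
  have hSs : ∀ i j, S i j = S j i := fun i j => partialDeriv_comm hφ.1 i j
  set T : EuclideanSpace ℝ (Fin n) → ℝ := fun x => ∑ i, S i i x with hT
  set α : EuclideanSpace ℝ (Fin n) → ℝ := fun x => ∑ i, x i * p i x with hα
  set q : Fin n → EuclideanSpace ℝ (Fin n) → ℝ := fun i x => ∑ j, x j * S i j x with hq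
  set P : EuclideanSpace ℝ (Fin n) → ℝ := fun x => ∑ i, p i x ^ 2 with hP
  set A : EuclideanSpace ℝ (Fin n) → ℝ := fun x => ∑ i, ∑ j, S i j x ^ 2 with hA
  set B : EuclideanSpace ℝ (Fin n) → ℝ := fun x => ∑ i, q i x ^ 2 with hB
  set C : EuclideanSpace ℝ (Fin n) → ℝ := fun x => ∑ i, p i x * q i x with hC
  set s : EuclideanSpace ℝ (Fin n) → ℝ := fun x => ∑ i, x i * q i x with hs
  have hTt : IsTestFunction T := .sum _ fun i => hSt i i
  have hαt : IsTestFunction α := .sum _ fun i => (hpt i).coord_mul i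
  have hqt : ∀ i, IsTestFunction (q i) := fun i => .sum _ fun j => (hSt i j).coord_mul j
  have hPt : IsTestFunction P := .sum _ fun i => by
    simpa only [pow_two] using (hpt i).mul_contDiff (hpt i).1
  have hxP : ∀ x i, partialDeriv i P x = 2 * ∑ j, p j x * S i j x := by
    intro x i
    have hPe : P = fun x => ∑ j, p j x * p j x := by simp only [hP, pow_two]
    rw [hPe, partialDeriv_sum _ fun j => (hpt j).1.mul (hpt j).1, Finset.mul_sum]
    refine Finset.sum_congr rfl fun j _ => ?_
    rw [partialDeriv_mul (hpt j).1 (hpt j).1, hdp]; ring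
  have hxα : ∀ x i, partialDeriv i α x = p i x + q i x := by
    intro x i
    rw [hα, partialDeriv_sum _ fun j => (contDiff_coord j).mul (hpt j).1]
    simp only [partialDeriv_mul (contDiff_coord _) (hpt _).1, hdp, partialDeriv_coord,
      Finset.sum_add_distrib, hq]
    simp [add_comm]
  have hdivx : ∀ (h : EuclideanSpace ℝ (Fin n) → ℝ), ContDiff ℝ ∞ h → ∀ x,
      ∑ i, partialDeriv i (fun y => y i * h y) x = n * h x + ∑ i, x i * partialDeriv i h x := by
    intro h hh x
    simp only [partialDeriv_mul (contDiff_coord _) hh, partialDeriv_coord, Finset.sum_add_distrib]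
    simp [add_comm]
  have hsumxα : ∀ x, ∑ i, x i * partialDeriv i α x = α x + s x := by
    intro x
    simp only [hxα, mul_add, Finset.sum_add_distrib]
    rfl
  -- the five divergence identities
  obtain ⟨i₁, z₁⟩ := integral_laplacian_sq_sub_hessian_sq hφ
  change Integrable (fun x => T x ^ 2 - A x) volume at i₁
  change ∫ x, (T x ^ 2 - A x) = 0 at z₁
  obtain ⟨i₂, z₂⟩ := integral_divergence_div_norm_sq hn fun i => hPt.coord_mul i
  have e₂ : ∀ x : EuclideanSpace ℝ (Fin n),
      (∑ i, partialDeriv i (fun y => y i * P y) x) / ‖x‖ ^ 2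
      - 2 * (∑ i, x i * (x i * P x)) / (‖x‖ ^ 2) ^ 2 =
      (n * P x + 2 * C x) / ‖x‖ ^ 2 - 2 * P x / ‖x‖ ^ 2 := by
    intro x
    have h1 : ∑ i, x i * (x i * P x) = ‖x‖ ^ 2 * P x := by
      simp only [← sum_coord_sq, Finset.sum_mul]
      exact Finset.sum_congr rfl fun i _ => by ring
    have h2 : ∑ i, x i * partialDeriv i P x = 2 * C x := by
      simp only [hxP, hC, hq, Finset.mul_sum]
      rw [Finset.sum_comm]
      refine Finset.sum_congr rfl fun i _ => Finset.sum_congr rfl fun j _ => ?_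
      rw [hSs j i]; ring
    rw [hdivx P hPt.1, h1, h2]
    congr 1
    rcases eq_or_ne (‖x‖ ^ 2) 0 with h0 | h0
    · simp [h0]
    · field_simp
  simp only [e₂] at i₂ z₂
  obtain ⟨i₃, z₃⟩ := integral_radial_divergence_div_norm_pow_four hn (hαt.mul_contDiff hαt.1)
  have e₃ : ∀ x : EuclideanSpace ℝ (Fin n),
      (∑ i, partialDeriv i (fun y => y i * (α y * α y)) x) / (‖x‖ ^ 2) ^ 2
      - 4 * (α x * α x) / (‖x‖ ^ 2) ^ 2 =
      (n * α x ^ 2 + 2 * α x * (α x + s x)) / (‖x‖ ^ 2) ^ 2 - 4 * α x ^ 2 / (‖x‖ ^ 2) ^ 2 := by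
    intro x
    rw [hdivx _ (hαt.1.mul hαt.1)]
    have : ∑ i, x i * partialDeriv i (fun y => α y * α y) x = 2 * α x * (α x + s x) := by
      rw [← hsumxα, Finset.mul_sum]
      refine Finset.sum_congr rfl fun i _ => ?_
      rw [partialDeriv_mul hαt.1 hαt.1]; ring
    rw [this]; ring
  simp only [e₃] at i₃ z₃
  obtain ⟨i₄, z₄⟩ := integral_divergence_div_norm_sq hn fun i => hαt.mul_contDiff (hpt i).1
  have e₄ : ∀ x : EuclideanSpace ℝ (Fin n),
      (∑ i, partialDeriv i (fun y => α y * p i y) x) / ‖x‖ ^ 2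
      - 2 * (∑ i, x i * (α x * p i x)) / (‖x‖ ^ 2) ^ 2 =
      (P x + C x + α x * T x) / ‖x‖ ^ 2 - 2 * α x ^ 2 / (‖x‖ ^ 2) ^ 2 := by
    intro x
    have h1 : ∑ i, x i * (α x * p i x) = α x ^ 2 := by
      rw [pow_two]
      conv_rhs => rw [hα]
      simp only [Finset.mul_sum]
      exact Finset.sum_congr rfl fun i _ => by simp only [hα]; ring
    have h2 : ∑ i, partialDeriv i (fun y => α y * p i y) x = P x + C x + α x * T x := by
      simp only [partialDeriv_mul hαt.1 (hpt _).1, hxα, hdp, Finset.sum_add_distrib,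
        ← Finset.mul_sum, mul_add, hP, hC, hT, pow_two]
      ring
    rw [h1, h2]
  simp only [e₄] at i₄ z₄
  -- The field Tx - Sx has divergence (n-1)T: the third derivatives of φ cancel, so only
  -- second-order invariants remain.
  have hV₆ : ∀ i : Fin n, IsTestFunction (fun x => T x * x i - q i x) := fun i =>
    (hTt.mul_contDiff (contDiff_coord i)).sub (hqt i)
  obtain ⟨i₆, z₆⟩ := integral_divergence_div_norm_sq hn fun i => hαt.mul_contDiff (hV₆ i).1
  have e₆ : ∀ x : EuclideanSpace ℝ (Fin n),
      (∑ i, partialDeriv i (fun y => α y * (T y * y i - q i y)) x) / ‖x‖ ^ 2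
      - 2 * (∑ i, x i * (α x * (T x * x i - q i x))) / (‖x‖ ^ 2) ^ 2 =
      (n * α x * T x - C x + s x * T x - B x) / ‖x‖ ^ 2
      - 2 * α x * (T x * ‖x‖ ^ 2 - s x) / (‖x‖ ^ 2) ^ 2 := by
    intro x
    have h1 : ∑ i, x i * (α x * (T x * x i - q i x)) = α x * (T x * ‖x‖ ^ 2 - s x) := by
      rw [← sum_coord_sq]
      simp only [hs, Finset.mul_sum, mul_sub, ← Finset.sum_sub_distrib]
      exact Finset.sum_congr rfl fun i _ => by ring
    have hdq : ∑ i, partialDeriv i (q i) x = T x + ∑ i, x i * partialDeriv i T x := by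
      have hdT : ∀ i, partialDeriv i T x = ∑ j, partialDeriv i (S j j) x := fun i =>
        partialDeriv_sum _ (fun j => (hSt j j).1) i x
      have hdqi : ∀ i, partialDeriv i (q i) x =
          S i i x + ∑ j, x j * partialDeriv i (S i j) x := by
        intro i
        rw [hq, partialDeriv_sum _ fun j => (contDiff_coord j).mul (hSt i j).1]
        simp only [partialDeriv_mul (contDiff_coord _) (hSt _ _).1, partialDeriv_coord,
          Finset.sum_add_distrib]
        simp [add_comm]
      simp only [hdqi, hdT, Finset.sum_add_distrib, Finset.mul_sum]
      congr 1
      rw [Finset.sum_comm]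
      refine Finset.sum_congr rfl fun i _ => Finset.sum_congr rfl fun j _ => ?_
      congr 1
      change partialDeriv j (partialDeriv j (p i)) x = partialDeriv i (partialDeriv j (p j)) x
      rw [partialDeriv_comm (hpt j).1 i j]
      have : partialDeriv i (p j) = partialDeriv j (p i) := hSs i j
      rw [this]
    have h2 : ∑ i, partialDeriv i (fun y => α y * (T y * y i - q i y)) x =
        n * α x * T x - C x + s x * T x - B x := by
      have h3 : ∀ i, partialDeriv i (fun y => α y * (T y * y i - q i y)) x =
          α x * (T x + x i * partialDeriv i T x - partialDeriv i (q i) x) +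
          (T x * (x i * p i x) + T x * (x i * q i x) - p i x * q i x - q i x ^ 2) := by
        intro i
        rw [partialDeriv_mul hαt.1 (hV₆ i).1,
          partialDeriv_sub (hTt.1.mul (contDiff_coord i)) (hqt i).1,
          partialDeriv_mul hTt.1 (contDiff_coord i), partialDeriv_coord, hxα]
        simp
        ring
      simp only [h3, Finset.sum_add_distrib, Finset.sum_sub_distrib, ← Finset.mul_sum]
      rw [hdq]
      simp only [Finset.sum_const, Finset.card_univ, Fintype.card_fin, nsmul_eq_mul, hα, hs, hC, hB]
      ring
    rw [h1, h2]
    ring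
  simp only [e₆] at i₆ z₆
  -- integrate the algebraic inequality
  have hle : ∀ᵐ x : EuclideanSpace ℝ (Fin n), ((n : ℝ) - 1) / (n - 2) * (T x ^ 2 - A x)
      - 2 / ((n : ℝ) - 2) * ((n * α x * T x - C x + s x * T x - B x) / ‖x‖ ^ 2
        - 2 * α x * (T x * ‖x‖ ^ 2 - s x) / (‖x‖ ^ 2) ^ 2)
      - ((n : ℝ) - 1 + 1 / (n - 2)) * ((n * P x + 2 * C x) / ‖x‖ ^ 2 - 2 * P x / ‖x‖ ^ 2)
      + (((n : ℝ) - 2) / 2 + 2 / (n - 2)) * ((n * α x ^ 2 + 2 * α x * (α x + s x)) / (‖x‖ ^ 2) ^ 2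
        - 4 * α x ^ 2 / (‖x‖ ^ 2) ^ 2)
      + 2 * ((P x + C x + α x * T x) / ‖x‖ ^ 2 - 2 * α x ^ 2 / (‖x‖ ^ 2) ^ 2)
      ≤ T x ^ 2 - (n : ℝ) ^ 2 / 4 * (P x / ‖x‖ ^ 2) := by
    have : Nonempty (Fin n) := ⟨⟨0, by omega⟩⟩
    have hne : ∀ᵐ x : EuclideanSpace ℝ (Fin n), x ≠ 0 := compl_mem_ae_iff.2 (measure_singleton _)
    filter_upwards [hne] with x hx
    have hR : 0 < ‖x‖ ^ 2 := by positivity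
    refine hardyRellich_algebraic hN hR ?_ ?_ ?_
    · exact sum_rejection_sq_nonneg (fun i => x i) (fun i => p i x) (fun i => q i x) _ _ _ _ _ _ _
        (sum_coord_sq x).symm hR rfl rfl rfl rfl rfl
    · simpa using trace_sq_le_of_compression (fun i j => S i j x)
        (fun i j => congrFun (hSs i j) x) (fun i => x i) (by simp; linarith) (fun i => q i x)
        (fun i => rfl) _ _ _ (sum_coord_sq x).symm hR rfl rfl
    · rw [← sum_coord_sq]
      exact Finset.sum_mul_sq_le_sq_mul_sq _ _ _
  have iT : Integrable (fun x => T x ^ 2) volume := by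
    simpa only [pow_two] using (hTt.mul_contDiff hTt.1).integrable
  have iP : Integrable (fun x => P x / ‖x‖ ^ 2) volume := by
    simpa using hPt.integrable_div_norm_pow (m := 1) (by omega)
  have j₁ := i₁.const_mul (((n : ℝ) - 1) / (n - 2))
  have j₆ := i₆.const_mul (2 / ((n : ℝ) - 2))
  have j₂ := i₂.const_mul ((n : ℝ) - 1 + 1 / (n - 2))
  have j₃ := i₃.const_mul (((n : ℝ) - 2) / 2 + 2 / (n - 2))
  have j₄ := i₄.const_mul 2
  have := integral_mono_ae ((((j₁.sub j₆).sub j₂).add j₃).add j₄) (iT.sub (iP.const_mul _)) hle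
  rw [integral_add' (((j₁.sub j₆).sub j₂).add j₃) j₄, integral_add' ((j₁.sub j₆).sub j₂) j₃,
    integral_sub' (j₁.sub j₆) j₂, integral_sub' j₁ j₆, integral_sub' iT (iP.const_mul _)] at this
  simp only [integral_const_mul, z₁, z₂, z₃, z₄, z₆] at this
  linarith

end HardyRellich

/-! ### Test functions as members of the Sobolev space, with classical derivatives. -/

section TestFunctions

variable {n : ℕ} {φ ψ : EuclideanSpace ℝ (Fin n) → ℝ}

namespace IsTestFunction

lemma fderiv_apply (hφ : IsTestFunction φ) (v : EuclideanSpace ℝ (Fin n)) :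
    IsTestFunction (fun x => fderiv ℝ φ x v) :=
  ⟨(hφ.1.fderiv_right (m := ∞) (by simp)).clm_apply contDiff_const, hφ.2.fderiv_apply (𝕜 := ℝ) v⟩

lemma laplacian_eq (hφ : IsTestFunction φ) :
    Δ φ = fun x => ∑ i, _root_.partialDeriv i (_root_.partialDeriv i φ) x :=
  funext fun x => laplacian_eq_sum_partialDeriv hφ.1 x

lemma laplacian (hφ : IsTestFunction φ) : IsTestFunction (Δ φ) := by
  rw [hφ.laplacian_eq]
  exact .sum _ fun i => (hφ.partialDeriv i).partialDeriv i

lemma continuous_gradient (hφ : IsTestFunction φ) : Continuous (gradient φ) :=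
  (InnerProductSpace.toDual ℝ (EuclideanSpace ℝ (Fin n))).symm.continuous.comp
    (hφ.1.continuous_fderiv (by simp))

lemma hasCompactSupport_gradient (hφ : IsTestFunction φ) : HasCompactSupport (gradient φ) :=
  (hφ.2.fderiv (𝕜 := ℝ)).comp_left
    (g := (InnerProductSpace.toDual ℝ (EuclideanSpace ℝ (Fin n))).symm) (map_zero _)

lemma laplacian_sub (hφ : IsTestFunction φ) (hψ : IsTestFunction ψ) :
    Δ (φ - ψ) = Δ φ - Δ ψ :=
  funext fun _ => (contDiff_infty.1 hφ.1 2).contDiffAt.laplacian_sub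
    (contDiff_infty.1 hψ.1 2).contDiffAt

lemma gradient_sub (hφ : IsTestFunction φ) (hψ : IsTestFunction ψ) :
    gradient (φ - ψ) = gradient φ - gradient ψ := by
  ext1 x
  simp [gradient, fderiv_sub (hφ.1.differentiable (by simp) x) (hψ.1.differentiable (by simp) x)]

lemma memLp (hφ : IsTestFunction φ) (p : ENNReal) : MemLp φ p volume :=
  hφ.continuous.memLp_of_hasCompactSupport hφ.2

end IsTestFunction

lemma norm_gradient_sq (x : EuclideanSpace ℝ (Fin n)) :
    ‖gradient φ x‖ ^ 2 = ∑ i, partialDeriv i φ x ^ 2 := by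
  rw [← (EuclideanSpace.basisFun (Fin n) ℝ).sum_sq_norm_inner_right]
  simp [inner_gradient_right, partialDeriv]

/-- The gradient of a test function, weighted by `‖x‖⁻¹`, is square integrable. -/
lemma memLp_inv_norm_smul_gradient (hn : 5 ≤ n) (hφ : IsTestFunction φ) :
    MemLp (fun x => ‖x‖⁻¹ • gradient φ x) 2 volume := by
  have hm : AEStronglyMeasurable (fun x => ‖x‖⁻¹ • gradient φ x) volume :=
    AEStronglyMeasurable.smul (measurable_norm.inv.aestronglyMeasurable)
      hφ.continuous_gradient.aestronglyMeasurable
  rw [memLp_two_iff_integrable_sq_norm hm]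
  have hc : HasCompactSupport fun x => ‖gradient φ x‖ ^ 2 :=
    hφ.hasCompactSupport_gradient.comp_left (g := fun y => ‖y‖ ^ 2) (by simp)
  refine (integrable_mul_inv_norm_pow (k := 2) (by omega)
    (f := fun x => ‖gradient φ x‖ ^ 2) (hφ.continuous_gradient.norm.pow 2) hc).congr
    (ae_of_all _ fun x => ?_)
  simp only [norm_smul, norm_inv, norm_norm]
  ring

theorem hardyRellich_testFunction (hn : 5 ≤ n) (hφ : IsTestFunction φ) :
    (n : ℝ) ^ 2 / 4 * ∫ x, ‖‖x‖⁻¹ • gradient φ x‖ ^ 2 ≤ ∫ x, ‖(Δ φ) x‖ ^ 2 := by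
  have h := hardyRellich_partialDeriv hn hφ
  simp only [← laplacian_eq_sum_partialDeriv hφ.1, ← norm_gradient_sq] at h
  have e : ∀ x, ‖‖x‖⁻¹ • gradient φ x‖ ^ 2 = ‖gradient φ x‖ ^ 2 / ‖x‖ ^ 2 := fun x => by
    simp only [norm_smul, norm_inv, norm_norm]
    ring
  simpa only [e, Real.norm_eq_abs, sq_abs] using h

lemma isWeakGradient_gradient (hφ : IsTestFunction φ) : IsWeakGradient φ (gradient φ) := by
  refine ⟨hφ.continuous.locallyIntegrable, hφ.continuous_gradient.locallyIntegrable,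
    fun ψ hψ v => ?_⟩
  simp only [inner_gradient_left]
  exact integral_mul_fderiv_eq_neg_fderiv_mul_of_integrable
    ((hφ.fderiv_apply v).mul_contDiff hψ.1).integrable
    (hφ.mul_contDiff (hψ.fderiv_apply v).1).integrable (hφ.mul_contDiff hψ.1).integrable
    (fun x _ => hφ.1.differentiable (by simp) x) (fun x _ => hψ.1.differentiable (by simp) x)

lemma isWeakLaplacian_laplacian (hφ : IsTestFunction φ) : IsWeakLaplacian φ (Δ φ) := by
  refine ⟨hφ.continuous.locallyIntegrable, hφ.laplacian.continuous.locallyIntegrable,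
    fun ψ hψ => ?_⟩
  simp only [laplacian_eq_sum_partialDeriv hφ.1, laplacian_eq_sum_partialDeriv hψ.1,
    Finset.mul_sum, Finset.sum_mul]
  rw [integral_finsetSum _ fun i _ =>
      (hφ.mul_contDiff ((hψ.partialDeriv i).partialDeriv i).1).integrable,
    integral_finsetSum _ fun i _ =>
      (((hφ.partialDeriv i).partialDeriv i).mul_contDiff hψ.1).integrable]
  refine Finset.sum_congr rfl fun i _ => ?_
  rw [integral_mul_partialDeriv hφ (hψ.partialDeriv i),
    integral_mul_partialDeriv (hφ.partialDeriv i) hψ, neg_neg]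

lemma memD22_of_isTestFunction (hφ : IsTestFunction φ) : MemD22 φ := by
  refine ⟨hφ.memLp _, fun _ => φ, fun _ => hφ, ?_, ?_⟩
  · have : Δ (φ - φ) = 0 := by rw [hφ.laplacian_sub hφ, sub_self]
    simp only [this, eLpNorm_zero, tendsto_const_nhds]
  · simp

end TestFunctions

/-! ### Almost everywhere uniqueness of weak derivatives. -/

section Uniqueness

variable {n : ℕ} {u : EuclideanSpace ℝ (Fin n) → ℝ}

lemma IsWeakGradient.ae_eq {G G' : EuclideanSpace ℝ (Fin n) → EuclideanSpace ℝ (Fin n)}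
    (h : IsWeakGradient u G) (h' : IsWeakGradient u G') : G =ᵐ[volume] G' := by
  have key : ∀ᵐ x, (G - G') x = 0 := by
    refine ae_eq_zero_of_integral_contDiff_smul_eq_zero (h.2.1.sub h'.2.1) fun g hg hgc => ?_
    have i₁ : Integrable (fun x => g x • G x) volume :=
      h.2.1.integrable_smul_left_of_hasCompactSupport hg.continuous hgc
    have i₂ : Integrable (fun x => g x • G' x) volume :=
      h'.2.1.integrable_smul_left_of_hasCompactSupport hg.continuous hgc
    simp only [Pi.sub_apply, smul_sub]
    rw [integral_sub i₁ i₂]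
    refine ext_inner_left ℝ fun v => ?_
    rw [inner_zero_right, inner_sub_right, ← integral_inner i₁, ← integral_inner i₂]
    have e := (h.2.2 g ⟨hg, hgc⟩ v).symm.trans (h'.2.2 g ⟨hg, hgc⟩ v)
    simp only [real_inner_comm _ v, real_inner_smul_left, mul_comm (g _)]
    linarith
  filter_upwards [key] with x hx using sub_eq_zero.1 hx

lemma IsWeakLaplacian.ae_eq {f f' : EuclideanSpace ℝ (Fin n) → ℝ}
    (h : IsWeakLaplacian u f) (h' : IsWeakLaplacian u f') : f =ᵐ[volume] f' := by
  have key : ∀ᵐ x, (f - f') x = 0 := by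
    refine ae_eq_zero_of_integral_contDiff_smul_eq_zero (h.2.1.sub h'.2.1) fun g hg hgc => ?_
    have i₁ : Integrable (fun x => g x • f x) volume :=
      h.2.1.integrable_smul_left_of_hasCompactSupport hg.continuous hgc
    have i₂ : Integrable (fun x => g x • f' x) volume :=
      h'.2.1.integrable_smul_left_of_hasCompactSupport hg.continuous hgc
    simp only [Pi.sub_apply, smul_sub]
    rw [integral_sub i₁ i₂]
    have e := (h.2.2 g ⟨hg, hgc⟩).symm.trans (h'.2.2 g ⟨hg, hgc⟩)
    simp only [smul_eq_mul, mul_comm (g _)]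
    linarith
  filter_upwards [key] with x hx using sub_eq_zero.1 hx

end Uniqueness

/-! ### Passage to the limit in the completion. -/

section Limits

lemma norm_toLp_sq {α F : Type*} [MeasurableSpace α] {μ : Measure α} [NormedAddCommGroup F]
    [InnerProductSpace ℝ F] {f : α → F} (hf : MemLp f 2 μ) :
    ‖hf.toLp f‖ ^ 2 = ∫ x, ‖f x‖ ^ 2 ∂μ := by
  rw [← real_inner_self_eq_norm_sq, L2.inner_def]
  refine integral_congr_ae ?_
  filter_upwards [hf.coeFn_toLp] with x hx
  rw [hx, real_inner_self_eq_norm_sq]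

/-- By Hölder; this carries the left sides of the weak derivative identities to the limit. -/
lemma tendsto_integral_mul_of_eLpNorm {α : Type*} [MeasurableSpace α] {μ : Measure α}
    {p q : ENNReal} [p.HolderTriple q 1] {F : ℕ → α → ℝ} {u g : α → ℝ}
    (hF : ∀ k, MemLp (F k) p μ) (hu : MemLp u p μ) (hg : MemLp g q μ)
    (h : Tendsto (fun k => eLpNorm (F k - u) p μ) atTop (𝓝 0)) :
    Tendsto (fun k => ∫ x, F k x * g x ∂μ) atTop (𝓝 (∫ x, u x * g x ∂μ)) := by
  refine tendsto_integral_of_L1' (F := fun k x => F k x * g x) (fun x => u x * g x)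
    (hu.1.mul hg.1) (Eventually.of_forall fun k => (hF k).integrable_mul hg) ?_
  have hlim : Tendsto (fun k => eLpNorm (F k - u) p μ * eLpNorm g q μ) atTop (𝓝 0) := by
    simpa using ENNReal.Tendsto.mul_const h (Or.inr hg.2.ne)
  refine tendsto_of_tendsto_of_tendsto_of_le_of_le tendsto_const_nhds hlim (fun _ => zero_le)
    fun k => ?_
  have : (fun x => F k x * g x) - (fun x => u x * g x) = (F k - u) • g := by
    ext x; simp [sub_mul]
  change eLpNorm ((fun x => F k x * g x) - (fun x => u x * g x)) 1 μ ≤ _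
  rw [this]
  exact eLpNorm_smul_le_mul_eLpNorm hg.1 ((hF k).1.sub hu.1)

variable {n : ℕ}

/-- Every function in `D^{2,2}` has weak derivatives with finite norms, which satisfy the
Hardy-Rellich inequality. -/
theorem MemD22.exists_weak_derivatives (hn : 5 ≤ n) {u : EuclideanSpace ℝ (Fin n) → ℝ}
    (hu : MemD22 u) :
    ∃ (G : EuclideanSpace ℝ (Fin n) → EuclideanSpace ℝ (Fin n))
      (f : EuclideanSpace ℝ (Fin n) → ℝ), IsWeakGradient u G ∧ IsWeakLaplacian u f ∧
      Integrable (fun x => (f x) ^ 2) volume ∧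
      Integrable (fun x => ‖x‖ ^ (-2 : ℤ) * ‖G x‖ ^ 2) volume ∧
      (n : ℝ) ^ 2 / 4 * ∫ x, ‖x‖ ^ (-2 : ℤ) * ‖G x‖ ^ 2 ≤ ∫ x, (f x) ^ 2 := by
  obtain ⟨hup, φ, hφ, hcau, hlim⟩ := hu
  have hN : (5 : ℝ) ≤ n := by exact_mod_cast hn
  set p : ENNReal := ENNReal.ofReal (2 * (n : ℝ) / ((n : ℝ) - 4)) with hp
  have hp1 : 1 ≤ p := by
    rw [hp, ENNReal.one_le_ofReal, le_div_iff₀ (by linarith)]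
    linarith
  have := ENNReal.HolderConjugate.conjExponent hp1
  have hL : ∀ k, MemLp (Δ (φ k)) 2 volume := fun k => (hφ k).laplacian.memLp 2
  have hH : ∀ k, MemLp (fun x => ‖x‖⁻¹ • gradient (φ k) x) 2 volume :=
    fun k => memLp_inv_norm_smul_gradient hn (hφ k)
  -- the Hardy-Rellich inequality in terms of norms
  have hle : ∀ (ψ : EuclideanSpace ℝ (Fin n) → ℝ) (hψ : IsTestFunction ψ),
      (n : ℝ) / 2 * ‖(memLp_inv_norm_smul_gradient hn hψ).toLp _‖ ≤
        ‖(hψ.laplacian.memLp 2).toLp _‖ := by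
    intro ψ hψ
    refine le_of_sq_le_sq ?_ (norm_nonneg _)
    rw [mul_pow, norm_toLp_sq, norm_toLp_sq]
    calc _ = (n : ℝ) ^ 2 / 4 * ∫ x, ‖‖x‖⁻¹ • gradient ψ x‖ ^ 2 := by ring
      _ ≤ _ := hardyRellich_testFunction hn hψ
  set FL : ℕ → Lp ℝ 2 (volume : Measure (EuclideanSpace ℝ (Fin n))) :=
    fun k => (hL k).toLp _ with hFL
  set FH : ℕ → Lp (EuclideanSpace ℝ (Fin n)) 2 (volume : Measure (EuclideanSpace ℝ (Fin n))) :=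
    fun k => (hH k).toLp _ with hFH
  have hsub : ∀ k l, IsTestFunction (φ k - φ l) := fun k l => (hφ k).sub (hφ l)
  have hdL : ∀ k l, dist (FL k) (FL l) = ‖((hsub k l).laplacian.memLp 2).toLp _‖ := by
    intro k l
    rw [dist_eq_norm, hFL, ← MemLp.toLp_sub]
    congr 2
    exact ((hφ k).laplacian_sub (hφ l)).symm
  have hdH : ∀ k l, dist (FH k) (FH l) =
      ‖(memLp_inv_norm_smul_gradient hn (hsub k l)).toLp _‖ := by
    intro k l
    rw [dist_eq_norm, hFH, ← MemLp.toLp_sub]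
    congr 2
    ext1 x
    simp [(hφ k).gradient_sub (hφ l), smul_sub]
  have hcL : Tendsto (fun k : ℕ × ℕ => dist (FL k.1) (FL k.2)) atTop (𝓝 0) := by
    have := (ENNReal.tendsto_toReal ENNReal.zero_ne_top).comp hcau
    refine this.congr fun k => ?_
    rw [hdL, Lp.norm_toLp]
    rfl
  -- The inequality for differences controls the weighted gradients by the Laplacians.
  have hcH : Tendsto (fun k : ℕ × ℕ => dist (FH k.1) (FH k.2)) atTop (𝓝 0) := by
    have h2 := hcL.const_mul (2 / (n : ℝ))
    rw [mul_zero] at h2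
    refine squeeze_zero (fun _ => dist_nonneg) (fun k => ?_) h2
    rw [hdL, hdH]
    have := hle _ (hsub k.1 k.2)
    rw [div_mul_eq_mul_div, le_div_iff₀ (by linarith)]
    linarith
  obtain ⟨F, hF⟩ := cauchySeq_tendsto_of_complete (cauchySeq_iff_tendsto_dist_atTop_0.2 hcL)
  obtain ⟨H, hHlim⟩ := cauchySeq_tendsto_of_complete (cauchySeq_iff_tendsto_dist_atTop_0.2 hcH)
  have hFm := Lp.memLp F
  have hHm := Lp.memLp H
  have hne : ∀ᵐ x : EuclideanSpace ℝ (Fin n), x ≠ 0 := by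
    have : Nonempty (Fin n) := ⟨⟨0, by omega⟩⟩
    exact compl_mem_ae_iff.2 (measure_singleton _)
  have hG : ∀ᵐ x : EuclideanSpace ℝ (Fin n),
      ‖H x‖ ^ 2 = ‖x‖ ^ (-2 : ℤ) * ‖‖x‖ • H x‖ ^ 2 := by
    filter_upwards [hne] with x hx
    have : ‖x‖ ≠ 0 := norm_ne_zero_iff.2 hx
    rw [norm_smul, norm_norm, zpow_neg]
    norm_cast
    field_simp
  refine ⟨fun x => ‖x‖ • H x, F, ⟨hup.locallyIntegrable hp1,
    (hHm.locallyIntegrable one_le_two).continuous_smul continuous_norm, fun ψ hψ v => ?_⟩,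
    ⟨hup.locallyIntegrable hp1, hFm.locallyIntegrable one_le_two, fun ψ hψ => ?_⟩,
    hFm.integrable_sq,
    ((memLp_two_iff_integrable_sq_norm hHm.1).1 hHm).congr hG, ?_⟩
  -- The weak gradient is ‖x‖ • H. Moving the factor ‖x‖ onto the test function turns the pairing
  -- into an L² inner product with H, where convergence is known.
  · have hW : MemLp (fun x => (‖x‖ * ψ x) • v) 2 volume := by
      refine Continuous.memLp_of_hasCompactSupport (by have := hψ.continuous; fun_prop) ?_
      exact (hψ.2.mul_left (f := fun x => ‖x‖)).smul_right
    have l₁ := tendsto_integral_mul_of_eLpNorm (q := p.conjExponent) (fun k => (hφ k).memLp p) hup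
      ((hψ.fderiv_apply v).memLp _) hlim
    have l₂ : Tendsto (fun k => - inner ℝ (FH k) (hW.toLp _)) atTop
        (𝓝 (- inner ℝ H (hW.toLp _))) := (hHlim.inner tendsto_const_nhds).neg
    have e₂ : inner ℝ H (hW.toLp _) = ∫ x, inner ℝ (‖x‖ • H x) v * ψ x := by
      rw [L2.inner_def]
      refine integral_congr_ae ?_
      filter_upwards [hW.coeFn_toLp] with x hx
      rw [hx, real_inner_smul_left, real_inner_smul_right]
      ring
    rw [e₂] at l₂
    refine tendsto_nhds_unique l₁ (l₂.congr fun k => ?_)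
    rw [(isWeakGradient_gradient (hφ k)).2.2 ψ hψ v, L2.inner_def]
    congr 1
    refine integral_congr_ae ?_
    filter_upwards [hW.coeFn_toLp, (hH k).coeFn_toLp, hne] with x hx hx' hx0
    have : ‖x‖ ≠ 0 := norm_ne_zero_iff.2 hx0
    rw [hx, hx', real_inner_smul_left, real_inner_smul_right]
    field_simp
  · have l₁ := tendsto_integral_mul_of_eLpNorm (q := p.conjExponent) (fun k => (hφ k).memLp p) hup
      (hψ.laplacian.memLp _) hlim
    have hW := hψ.memLp 2
    have l₂ : Tendsto (fun k => inner ℝ (FL k) (hW.toLp _)) atTop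
        (𝓝 (inner ℝ F (hW.toLp _))) := hF.inner tendsto_const_nhds
    have e₂ : inner ℝ F (hW.toLp _) = ∫ x, F x * ψ x := by
      rw [L2.inner_def]
      refine integral_congr_ae ?_
      filter_upwards [hW.coeFn_toLp] with x hx
      rw [hx]
      simp [mul_comm]
    rw [e₂] at l₂
    refine tendsto_nhds_unique l₁ (l₂.congr fun k => ?_)
    rw [(isWeakLaplacian_laplacian (hφ k)).2.2 ψ hψ, L2.inner_def]
    refine integral_congr_ae ?_
    filter_upwards [hW.coeFn_toLp, (hL k).coeFn_toLp] with x hx hx'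
    rw [hx, hx']
    simp [mul_comm]
  · have hnorm : (n : ℝ) / 2 * ‖H‖ ≤ ‖F‖ :=
      le_of_tendsto_of_tendsto' (hHlim.norm.const_mul _) hF.norm fun k => hle _ (hφ k)
    have h1 : ‖H‖ ^ 2 = ∫ x, ‖x‖ ^ (-2 : ℤ) * ‖‖x‖ • H x‖ ^ 2 := by
      rw [← integral_congr_ae hG, ← norm_toLp_sq hHm, Lp.toLp_coeFn]
    have h2 : ‖F‖ ^ 2 = ∫ x, F x ^ 2 := by
      conv_lhs => rw [← Lp.toLp_coeFn F hFm, norm_toLp_sq hFm]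
      simp
    rw [← h1, ← h2]
    calc (n : ℝ) ^ 2 / 4 * ‖H‖ ^ 2 = ((n : ℝ) / 2 * ‖H‖) ^ 2 := by ring
      _ ≤ ‖F‖ ^ 2 := by gcongr

end Limits

/-! ### Radial functions in the variable log ‖x‖. -/

section Radial

variable {n : ℕ}

lemma hasFDerivAt_log_norm {x : EuclideanSpace ℝ (Fin n)} (hx : x ≠ 0) :
    HasFDerivAt (fun y : EuclideanSpace ℝ (Fin n) => Real.log ‖y‖)
      ((‖x‖ ^ 2)⁻¹ • innerSL ℝ x) x := by
  have hx' : ‖x‖ ≠ 0 := norm_ne_zero_iff.2 hx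
  have h := ((hasStrictFDerivAt_norm_sq x).hasFDerivAt.log (pow_ne_zero 2 hx')).const_mul (1 / 2)
  have e : (fun y : EuclideanSpace ℝ (Fin n) => Real.log ‖y‖) =
      fun y => 1 / 2 * Real.log (‖y‖ ^ 2) := by
    ext y
    rw [Real.log_pow]
    push_cast
    ring
  rw [e]
  refine h.congr_fderiv ?_
  ext v
  simp
  ring

variable {Q Q' Q'' : ℝ → ℝ}

/-- Vanishing for t ≤ 0 makes the function zero on the unit ball; this includes the origin, where
`Real.log 0 = 0`. -/
lemma isTestFunction_comp_log_norm (hQ : ContDiff ℝ ∞ Q) (h0 : ∀ t ≤ 0, Q t = 0) {M : ℝ}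
    (hM : ∀ t, M ≤ t → Q t = 0) :
    IsTestFunction (fun x : EuclideanSpace ℝ (Fin n) => Q (Real.log ‖x‖)) := by
  constructor
  · rw [contDiff_iff_contDiffAt]
    intro x
    rcases eq_or_ne x 0 with rfl | hx
    · have : (fun x : EuclideanSpace ℝ (Fin n) => Q (Real.log ‖x‖)) =ᶠ[𝓝 0] fun _ => 0 := by
        filter_upwards [Metric.ball_mem_nhds 0 one_pos] with y hy
        exact h0 _ (Real.log_nonpos (norm_nonneg _) (mem_ball_zero_iff.1 hy).le)
      exact contDiffAt_const.congr_of_eventuallyEq this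
    · exact hQ.contDiffAt.comp x ((contDiffAt_norm ℝ hx).log (norm_ne_zero_iff.2 hx))
  · refine HasCompactSupport.intro (isCompact_closedBall 0 (Real.exp M)) fun x hx => ?_
    have hx' : Real.exp M < ‖x‖ := by simpa using hx
    exact hM _ ((Real.le_log_iff_exp_le ((Real.exp_pos M).trans hx')).2 hx'.le)

lemma partialDeriv_comp_log_norm (h₁ : ∀ t, HasDerivAt Q (Q' t) t) (i : Fin n)
    {x : EuclideanSpace ℝ (Fin n)} (hx : x ≠ 0) :
    partialDeriv i (fun y => Q (Real.log ‖y‖)) x = Q' (Real.log ‖x‖) * (x i * (‖x‖ ^ 2)⁻¹) := by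
  have d : HasFDerivAt (fun y : EuclideanSpace ℝ (Fin n) => Q (Real.log ‖y‖)) _ x :=
    (h₁ _).comp_hasFDerivAt x (hasFDerivAt_log_norm hx)
  unfold partialDeriv
  rw [d.fderiv]
  simp [EuclideanSpace.inner_single_right]
  exact Or.inl (mul_comm _ _)

lemma partialDeriv_partialDeriv_comp_log_norm (h₁ : ∀ t, HasDerivAt Q (Q' t) t)
    (h₂ : ∀ t, HasDerivAt Q' (Q'' t) t) (i : Fin n) {x : EuclideanSpace ℝ (Fin n)} (hx : x ≠ 0) :
    partialDeriv i (partialDeriv i (fun y => Q (Real.log ‖y‖))) x =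
      ((Q'' (Real.log ‖x‖) - 2 * Q' (Real.log ‖x‖)) * (x i ^ 2 / ‖x‖ ^ 2)
        + Q' (Real.log ‖x‖)) / ‖x‖ ^ 2 := by
  have hx' : ‖x‖ ≠ 0 := norm_ne_zero_iff.2 hx
  have e : partialDeriv i (fun y : EuclideanSpace ℝ (Fin n) => Q (Real.log ‖y‖)) =ᶠ[𝓝 x]
      fun y => Q' (Real.log ‖y‖) * (y i * (‖y‖ ^ 2)⁻¹) := by
    filter_upwards [isOpen_ne.mem_nhds hx] with y hy
    exact partialDeriv_comp_log_norm h₁ i hy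
  have d₁ := (h₂ _).comp_hasFDerivAt x (hasFDerivAt_log_norm hx)
  have d₂ : HasFDerivAt (fun y : EuclideanSpace ℝ (Fin n) => y i)
    (EuclideanSpace.proj (𝕜 := ℝ) i) x := (EuclideanSpace.proj (𝕜 := ℝ) i).hasFDerivAt
  have d₃ := (hasDerivAt_inv (pow_ne_zero 2 hx')).comp_hasFDerivAt x
    (hasStrictFDerivAt_norm_sq x).hasFDerivAt
  have d : HasFDerivAt (fun y : EuclideanSpace ℝ (Fin n) =>
    Q' (Real.log ‖y‖) * (y i * (‖y‖ ^ 2)⁻¹)) _ x := d₁.mul (d₂.mul d₃)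
  change fderiv ℝ (partialDeriv i _) x _ = _
  rw [e.fderiv_eq, d.fderiv]
  simp [EuclideanSpace.inner_single_right]
  field_simp
  ring

lemma laplacian_comp_log_norm (hφ : IsTestFunction
      (fun x : EuclideanSpace ℝ (Fin n) => Q (Real.log ‖x‖)))
    (h₁ : ∀ t, HasDerivAt Q (Q' t) t) (h₂ : ∀ t, HasDerivAt Q' (Q'' t) t)
    {x : EuclideanSpace ℝ (Fin n)} (hx : x ≠ 0) :
    (Δ (fun y : EuclideanSpace ℝ (Fin n) => Q (Real.log ‖y‖))) x =
      (Q'' (Real.log ‖x‖) + (n - 2) * Q' (Real.log ‖x‖)) / ‖x‖ ^ 2 := by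
  have hx' : ‖x‖ ≠ 0 := norm_ne_zero_iff.2 hx
  rw [laplacian_eq_sum_partialDeriv hφ.1]
  simp only [partialDeriv_partialDeriv_comp_log_norm h₁ h₂ _ hx]
  rw [← Finset.sum_div, Finset.sum_add_distrib, ← Finset.mul_sum, ← Finset.sum_div, sum_coord_sq]
  simp only [Finset.sum_const, Finset.card_univ, Fintype.card_fin, nsmul_eq_mul]
  field_simp
  ring

lemma norm_gradient_comp_log_norm_sq (h₁ : ∀ t, HasDerivAt Q (Q' t) t)
    {x : EuclideanSpace ℝ (Fin n)} (hx : x ≠ 0) :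
    ‖gradient (fun y : EuclideanSpace ℝ (Fin n) => Q (Real.log ‖y‖)) x‖ ^ 2 =
      Q' (Real.log ‖x‖) ^ 2 / ‖x‖ ^ 2 := by
  have hx' : ‖x‖ ≠ 0 := norm_ne_zero_iff.2 hx
  rw [norm_gradient_sq]
  simp only [partialDeriv_comp_log_norm h₁ _ hx, mul_pow]
  rw [← Finset.mul_sum, ← Finset.sum_mul, sum_coord_sq]
  field_simp

/-- The substitution r = exp t; no integrability is required of K. -/
lemma integral_comp_log_Ioi_zero (K : ℝ → ℝ) :
    ∫ r in Set.Ioi (0 : ℝ), r⁻¹ * K (Real.log r) = ∫ t, K t := by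
  have h := integral_image_eq_integral_abs_deriv_smul (MeasurableSet.univ (α := ℝ))
    (fun x _ => (Real.hasDerivAt_exp x).hasDerivWithinAt) Real.exp_injective.injOn
    (fun r => r⁻¹ * K (Real.log r))
  rw [Set.image_univ, Real.range_exp] at h
  rw [h, setIntegral_univ]
  congr 1 with t
  simp

/-- Integration of a radial function in logarithmic coordinates. -/
lemma integral_inv_norm_pow_mul_comp_log_norm (hn : 0 < n) (K : ℝ → ℝ) :
    ∫ x : EuclideanSpace ℝ (Fin n), (‖x‖ ^ n)⁻¹ * K (Real.log ‖x‖) =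
      n * volume.real (Metric.ball (0 : EuclideanSpace ℝ (Fin n)) 1) * ∫ t, K t := by
  have : Nonempty (Fin n) := ⟨⟨0, hn⟩⟩
  rw [integral_fun_norm_addHaar volume (fun r => (r ^ n)⁻¹ * K (Real.log r)),
    ← integral_comp_log_Ioi_zero]
  simp only [finrank_euclideanSpace, Fintype.card_fin, nsmul_eq_mul, smul_eq_mul, ← mul_assoc]
  congr 1
  refine setIntegral_congr_fun measurableSet_Ioi fun r (hr : 0 < r) => ?_
  obtain ⟨m, rfl⟩ : ∃ m, n = m + 1 := ⟨n - 1, by omega⟩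
  simp only [Nat.add_sub_cancel]
  field_simp
  ring

end Radial

/-! ### Optimality of the constant. -/

section Sharpness

variable {n : ℕ}

/-- A constant in the Hardy-Rellich inequality for test functions is a constant in a one-dimensional
inequality, by inserting functions of the form `‖x‖ ^ (-(n-4)/2) W(ε log ‖x‖)`. -/
lemma one_dimensional_inequality (hn : 5 ≤ n) {c : ℝ}
    (hc : ∀ φ : EuclideanSpace ℝ (Fin n) → ℝ, IsTestFunction φ →
      c * ∫ x, ‖x‖ ^ (-2 : ℤ) * ‖gradient φ x‖ ^ 2 ≤ ∫ x, (Δ φ) x ^ 2)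
    {W : ℝ → ℝ} (hW : ContDiff ℝ ∞ W) (h0 : ∀ t ≤ 0, W t = 0) (h2 : ∀ t, 2 ≤ t → W t = 0)
    {ε : ℝ} (hε : 0 < ε) :
    c * ∫ t, (ε * deriv W t - ((n : ℝ) - 4) / 2 * W t) ^ 2 ≤
      ∫ t, (ε ^ 2 * deriv (deriv W) t + 2 * ε * deriv W t
        - (n : ℝ) * (n - 4) / 4 * W t) ^ 2 := by
  have hN : (5 : ℝ) ≤ n := by exact_mod_cast hn
  set b : ℝ := ((n : ℝ) - 4) / 2 with hb
  have hW' : ContDiff ℝ ∞ (deriv W) := (contDiff_infty_iff_deriv.1 hW).2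
  have dW : ∀ t, HasDerivAt W (deriv W t) t := fun t =>
    (hW.differentiable (by simp) t).hasDerivAt
  have dW' : ∀ t, HasDerivAt (deriv W) (deriv (deriv W) t) t := fun t =>
    (hW'.differentiable (by simp) t).hasDerivAt
  have dε : ∀ t : ℝ, HasDerivAt (fun t => ε * t) ε t := fun t => by
    simpa using (hasDerivAt_id t).const_mul ε
  have dexp : ∀ t : ℝ, HasDerivAt (fun t => Real.exp (-b * t)) (Real.exp (-b * t) * -b) t :=
    fun t => by simpa using ((hasDerivAt_id t).const_mul (-b)).exp
  set Q : ℝ → ℝ := fun t => Real.exp (-b * t) * W (ε * t) with hQ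
  set Q' : ℝ → ℝ := fun t => Real.exp (-b * t) * (ε * deriv W (ε * t) - b * W (ε * t)) with hQ'
  set Q'' : ℝ → ℝ := fun t => Real.exp (-b * t) * (ε ^ 2 * deriv (deriv W) (ε * t)
    - 2 * b * ε * deriv W (ε * t) + b ^ 2 * W (ε * t)) with hQ''
  have d₁ : ∀ t, HasDerivAt Q (Q' t) t := fun t => by
    refine ((dexp t).mul ((dW (ε * t)).comp t (dε t))).congr_deriv ?_
    simp only [hQ', Function.comp]
    ring
  have d₂ : ∀ t, HasDerivAt Q' (Q'' t) t := fun t => by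
    refine ((dexp t).mul ((((dW' (ε * t)).comp t (dε t)).const_mul ε).sub
      (((dW (ε * t)).comp t (dε t)).const_mul b))).congr_deriv ?_
    simp only [hQ'', Function.comp, Pi.sub_apply]
    ring
  have hφ : IsTestFunction (fun x : EuclideanSpace ℝ (Fin n) => Q (Real.log ‖x‖)) := by
    refine isTestFunction_comp_log_norm (M := 2 / ε) ?_ (fun t ht => ?_) fun t ht => ?_
    · exact (contDiff_const.mul contDiff_id).exp.mul (hW.comp (contDiff_const.mul contDiff_id))
    · simp only [hQ]
      rw [h0 _ (mul_nonpos_of_nonneg_of_nonpos hε.le ht), mul_zero]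
    · simp only [hQ]
      rw [h2, mul_zero]
      rwa [div_le_iff₀' hε] at ht
  have hne : ∀ᵐ x : EuclideanSpace ℝ (Fin n), x ≠ 0 := by
    have : Nonempty (Fin n) := ⟨⟨0, by omega⟩⟩
    exact compl_mem_ae_iff.2 (measure_singleton _)
  -- The choice of b makes this r^(4-n). Both integrands carry a further r⁻⁴, so the weight becomes
  -- r⁻ⁿ, which is dt in logarithmic coordinates.
  have hexp : ∀ r : ℝ, 0 < r → Real.exp (-b * Real.log r) ^ 2 = (r ^ n)⁻¹ * r ^ 4 := by
    intro r hr
    rw [← Real.exp_nat_mul, show ((2 : ℕ) : ℝ) * (-b * Real.log r) =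
      -(Real.log r * n) + Real.log r * (4 : ℕ) by rw [hb]; push_cast; ring,
      Real.exp_add, Real.exp_neg, ← Real.rpow_def_of_pos hr, ← Real.rpow_def_of_pos hr,
      Real.rpow_natCast, Real.rpow_natCast]
  have hscale : ∀ g : ℝ → ℝ, ∫ t, g (ε * t) = ε⁻¹ * ∫ t, g t := fun g => by
    rw [Measure.integral_comp_mul_left, abs_of_pos (inv_pos.2 hε), smul_eq_mul]
  have e₁ : ∫ x, ‖x‖ ^ (-2 : ℤ) *
      ‖gradient (fun x : EuclideanSpace ℝ (Fin n) => Q (Real.log ‖x‖)) x‖ ^ 2 =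
      n * volume.real (Metric.ball (0 : EuclideanSpace ℝ (Fin n)) 1) *
        (ε⁻¹ * ∫ t, (ε * deriv W t - b * W t) ^ 2) := by
    rw [← hscale fun t => (ε * deriv W t - b * W t) ^ 2,
      ← integral_inv_norm_pow_mul_comp_log_norm (by omega)
        fun t => (ε * deriv W (ε * t) - b * W (ε * t)) ^ 2]
    refine integral_congr_ae ?_
    filter_upwards [hne] with x hx
    have hx' : 0 < ‖x‖ := norm_pos_iff.2 hx
    rw [norm_gradient_comp_log_norm_sq d₁ hx]
    simp only [hQ']
    rw [mul_pow, hexp _ hx', zpow_neg]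
    norm_cast
    field_simp
  have e₂ : ∫ x, (Δ (fun x : EuclideanSpace ℝ (Fin n) => Q (Real.log ‖x‖))) x ^ 2 =
      n * volume.real (Metric.ball (0 : EuclideanSpace ℝ (Fin n)) 1) *
        (ε⁻¹ * ∫ t, (ε ^ 2 * deriv (deriv W) t + 2 * ε * deriv W t
        - (n : ℝ) * (n - 4) / 4 * W t) ^ 2) := by
    rw [← hscale fun t => (ε ^ 2 * deriv (deriv W) t + 2 * ε * deriv W t
        - (n : ℝ) * (n - 4) / 4 * W t) ^ 2,
      ← integral_inv_norm_pow_mul_comp_log_norm (by omega)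
        fun t => (ε ^ 2 * deriv (deriv W) (ε * t) + 2 * ε * deriv W (ε * t)
        - (n : ℝ) * (n - 4) / 4 * W (ε * t)) ^ 2]
    refine integral_congr_ae ?_
    filter_upwards [hne] with x hx
    have hx' : 0 < ‖x‖ := norm_pos_iff.2 hx
    rw [laplacian_comp_log_norm hφ d₁ d₂ hx]
    have : Q'' (Real.log ‖x‖) + (n - 2) * Q' (Real.log ‖x‖) = Real.exp (-b * Real.log ‖x‖) *
        (ε ^ 2 * deriv (deriv W) (ε * Real.log ‖x‖) + 2 * ε * deriv W (ε * Real.log ‖x‖)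
        - (n : ℝ) * (n - 4) / 4 * W (ε * Real.log ‖x‖)) := by
      simp only [hQ'', hQ', hb]
      ring
    rw [this, div_pow, mul_pow, hexp _ hx']
    field_simp
  have h := hc _ hφ
  rw [e₁, e₂] at h
  have hpos : 0 < (n : ℝ) * volume.real (Metric.ball (0 : EuclideanSpace ℝ (Fin n)) 1) * ε⁻¹ := by
    have : 0 < volume.real (Metric.ball (0 : EuclideanSpace ℝ (Fin n)) 1) :=
      ENNReal.toReal_pos (Metric.measure_ball_pos _ _ one_pos).ne' measure_ball_lt_top.ne
    have : (0 : ℝ) < n := by linarith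
    positivity
  refine le_of_mul_le_mul_left ?_ hpos
  linarith

lemma hardyRellich_constant_le (hn : 5 ≤ n) {c : ℝ}
    (hc : ∀ φ : EuclideanSpace ℝ (Fin n) → ℝ, IsTestFunction φ →
      c * ∫ x, ‖x‖ ^ (-2 : ℤ) * ‖gradient φ x‖ ^ 2 ≤ ∫ x, (Δ φ) x ^ 2) :
    c ≤ (n : ℝ) ^ 2 / 4 := by
  have hN : (5 : ℝ) ≤ n := by exact_mod_cast hn
  -- Centre 1 and outer radius 1 give a profile vanishing for t ≤ 0 and for t ≥ 2.
  let W : ContDiffBump (1 : ℝ) := ⟨1 / 2, 1, by norm_num, by norm_num⟩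
  have hW : ContDiff ℝ ∞ W := W.contDiff
  have hW' : ContDiff ℝ ∞ (deriv W) := (contDiff_infty_iff_deriv.1 hW).2
  have hW'' : ContDiff ℝ ∞ (deriv (deriv W)) := (contDiff_infty_iff_deriv.1 hW').2
  have c₀ := hW.continuous
  have c₁ := hW'.continuous
  have c₂ := hW''.continuous
  have hWcs : HasCompactSupport W := W.hasCompactSupport
  have hzero : ∀ t, 1 ≤ dist t 1 → W t = 0 := fun t ht => W.zero_of_le_dist ht
  have z₀ : ∀ t ∉ tsupport W, W t = 0 := fun t ht => image_eq_zero_of_notMem_tsupport ht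
  have z₁ : ∀ t ∉ tsupport W, deriv W t = 0 := fun t ht =>
    Function.notMem_support.1 fun h => ht (support_deriv_subset h)
  have z₂ : ∀ t ∉ tsupport W, deriv (deriv W) t = 0 := fun t ht =>
    Function.notMem_support.1 fun h => ht
      (closure_minimal support_deriv_subset (isClosed_tsupport _) (support_deriv_subset h))
  -- Restricting to the fixed compact support makes both sides continuous in ε up to ε = 0, where
  -- only the W terms survive: c((n-4)/2)² ≤ (n(n-4)/4)².
  have key : ∀ ε : ℝ, 0 < ε →
      c * ∫ t in tsupport W, (ε * deriv W t - ((n : ℝ) - 4) / 2 * W t) ^ 2 ≤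
      ∫ t in tsupport W, (ε ^ 2 * deriv (deriv W) t + 2 * ε * deriv W t
        - (n : ℝ) * (n - 4) / 4 * W t) ^ 2 := by
    intro ε hε
    rw [setIntegral_eq_integral_of_forall_compl_eq_zero fun t ht => by simp [z₀ t ht, z₁ t ht],
      setIntegral_eq_integral_of_forall_compl_eq_zero fun t ht => by
        simp [z₀ t ht, z₁ t ht, z₂ t ht]]
    refine one_dimensional_inequality hn hc hW (fun t ht => hzero t ?_) (fun t ht => hzero t ?_) hε
    · rw [Real.dist_eq, abs_sub_comm]
      exact (le_abs_self _).trans' (by linarith)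
    · rw [Real.dist_eq]
      exact (le_abs_self _).trans' (by linarith)
  have l₁ : Continuous fun ε : ℝ =>
      c * ∫ t in tsupport W, (ε * deriv W t - ((n : ℝ) - 4) / 2 * W t) ^ 2 :=
    continuous_const.mul (continuous_parametric_integral_of_continuous
      (by simp only [Function.uncurry_def]; fun_prop) hWcs)
  have l₂ : Continuous fun ε : ℝ => ∫ t in tsupport W, (ε ^ 2 * deriv (deriv W) t
      + 2 * ε * deriv W t - (n : ℝ) * (n - 4) / 4 * W t) ^ 2 :=
    continuous_parametric_integral_of_continuous
      (by simp only [Function.uncurry_def]; fun_prop) hWcs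
  have lim := le_of_tendsto_of_tendsto (l₁.continuousWithinAt (s := Set.Ioi 0) (x := 0))
    (l₂.continuousWithinAt (s := Set.Ioi 0) (x := 0))
    (by filter_upwards [self_mem_nhdsWithin] with ε hε using key ε hε)
  have hpos : 0 < ∫ t in tsupport W, W t ^ 2 := by
    rw [setIntegral_eq_integral_of_forall_compl_eq_zero fun t ht => by simp [z₀ t ht]]
    refine Continuous.integral_pos_of_hasCompactSupport_nonneg_nonzero (x := 1) (by fun_prop)
      (hWcs.comp_left (g := fun y => y ^ 2) (by simp)) (fun t => sq_nonneg _) ?_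
    have : W 1 = 1 := W.one_of_mem_closedBall (Metric.mem_closedBall_self (by norm_num [W]))
    simp [this]
  simp only [zero_mul, zero_sub, mul_zero, ne_eq, OfNat.ofNat_ne_zero, not_false_eq_true, zero_pow,
    add_zero, neg_sq, mul_pow, integral_const_mul] at lim
  rw [← mul_assoc] at lim
  have := le_of_mul_le_mul_right lim hpos
  have h4 : 0 < (((n : ℝ) - 4) / 2) ^ 2 := by
    have : 0 < (n : ℝ) - 4 := by linarith
    positivity
  refine le_of_mul_le_mul_right (this.trans_eq ?_) h4
  ring

end Sharpness

theorem mainTheorem4 (n : ℕ) (hn : 5 ≤ n) :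
    (∀ u : EuclideanSpace ℝ (Fin n) → ℝ, MemD22 u →
      ∃ (G : EuclideanSpace ℝ (Fin n) → EuclideanSpace ℝ (Fin n))
        (f : EuclideanSpace ℝ (Fin n) → ℝ),
        IsWeakGradient u G ∧ IsWeakLaplacian u f ∧
        Integrable (fun x => (f x) ^ 2) volume ∧
        Integrable (fun x => ‖x‖ ^ (-2 : ℤ) * ‖G x‖ ^ 2) volume) ∧
    IsGreatest
      {c : ℝ | ∀ (u : EuclideanSpace ℝ (Fin n) → ℝ)
        (G : EuclideanSpace ℝ (Fin n) → EuclideanSpace ℝ (Fin n))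
        (f : EuclideanSpace ℝ (Fin n) → ℝ),
        MemD22 u → IsWeakGradient u G → IsWeakLaplacian u f →
          ∫ x, (f x) ^ 2 ≥ c * ∫ x, ‖x‖ ^ (-2 : ℤ) * ‖G x‖ ^ 2}
      ((n : ℝ) ^ 2 / 4) := by
  refine ⟨fun u hu => ?_, fun u G f hu hG hf => ?_, fun c hc => ?_⟩
  · obtain ⟨G, f, hG, hf, hi, hi', -⟩ := hu.exists_weak_derivatives hn
    exact ⟨G, f, hG, hf, hi, hi'⟩
  · obtain ⟨G', f', hG', hf', -, -, h⟩ := hu.exists_weak_derivatives hn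
    have e₁ : ∫ x, ‖x‖ ^ (-2 : ℤ) * ‖G x‖ ^ 2 = ∫ x, ‖x‖ ^ (-2 : ℤ) * ‖G' x‖ ^ 2 :=
      integral_congr_ae (by filter_upwards [hG.ae_eq hG'] with x hx; rw [hx])
    have e₂ : ∫ x, f x ^ 2 = ∫ x, f' x ^ 2 :=
      integral_congr_ae (by filter_upwards [hf.ae_eq hf'] with x hx; rw [hx])
    rw [e₁, e₂]
    exact h
  -- Testing an admissible c on smooth functions with their classical derivatives already bounds it.
  · exact hardyRellich_constant_le hn fun φ hφ => hc φ (gradient φ) (Δ φ)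
      (memD22_of_isTestFunction hφ) (isWeakGradient_gradient hφ) (isWeakLaplacian_laplacian hφ)
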